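/- Let $d\ge 1$ be an integer. For odd $n\ge 3$ let $\mathbb{T}_n^d=(\mathbb{Z}/n\mathbb{Z})^d$ be the discrete torus with its nearest-neighbour graph structure $\sim$, and let $P=(p_{\mathbf i\mathbf j})$ be the transition matrix of the simple random walk on it: $p_{\mathbf i\mathbf j}=\frac1{2d}$ if $\mathbf i\sim\mathbf j$, and $p_{\mathbf i\mathbf j}=0$ otherwise. The smoothing process $\mathbf Y(t)=(Y_{\mathbf i}(t))_{\mathbf i\in\mathbb{T}_n^d}$, $t\ge 0$, starts from an arbitrary (possibly random) configuration $Y_{\mathbf i}(0)=y_{\mathbf i}\in\mathbb{R}$. Each site carries a Poisson clock of rate $1$; the clocks are jointly independent and independent of $\mathbf Y(0)$. When the clock at $\mathbf k$ rings at time $t$, the value at $\mathbf k$ is updated to $Y_{\mathbf k}(t)=\sum_{\mathbf j}p_{\mathbf k\mathbf j}Y_{\mathbf j}(t-)$, and the values at the other sites do not change. Let $y^*$ be the median of the $n^d$ values $y_{\mathbf i}$, $\mathbf i\in\mathbb{T}_n^d$ (counted with multiplicity, for each realization of the initial configuration). Put $\gamma_1^{(1)}=1-\cos(2\pi/n)$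 and $\overline Y(t)=n^{-d}\sum_{\mathbf i\in\mathbb{T}_n^d}Y_{\mathbf i}(t)$. There exist constants $\alpha_2,\alpha_3>0$, $n_0\ge 3$ and $t_0>0$, all depending only on $d$, such that for every odd $n\ge n_0$ and every such smoothing process, the limit $\overline Y(\infty)=\lim_{t\to\infty}\overline Y(t)$ exists almost surely and, for all $t\ge t_0$, $$ \mathbb{E}\left(\overline Y(t)-\overline Y(\infty)\right)^2\le\frac{\alpha_2}{t^{\frac d2+1}\wedge n^{d+2}}\;\mathbb{E}\left[\left(n^{-d}\sum_{\mathbf i\in\mathbb{T}_n^d}|y_{\mathbf i}-y^*|\right)^2\right]\exp\left(-\left(\frac{2\gamma_1^{(1)}}d-\frac{\alpha_3}{n^{d+4}}\right)t\right), $$ where $a\wedge b=\min(a,b)$ and the expectations take values in $[0,\infty]$. -/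

import Mathlib

open MeasureTheory ProbabilityTheory Filter Topology
open scoped NNReal ENNReal

/-- `N` is a rate one Poisson process on `ℝ≥0` (a counting process: almost every path starts
at zero, is non-decreasing and right-continuous). -/
structure IsUnitPoissonProcess {Ω : Type*} [MeasurableSpace Ω] (N : ℝ≥0 → Ω → ℕ)
    (P : Measure Ω) : Prop where
  measurable : ∀ t, Measurable (N t)
  path : ∀ᵐ ω ∂P, N 0 ω = 0 ∧ Monotone (fun t => N t ω) ∧
    ∀ t, ContinuousWithinAt (fun s => N s ω) (Set.Ici t) t
  indepIncrements : HasIndepIncrements N P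
  increment_law : ∀ s t, s ≤ t → HasLaw (fun ω => N t ω - N s ω) (poissonMeasure (t - s)) P

/-- The clock with counting path `c` rings at time `t`, i.e. `c` jumps at `t`. -/
def RingsAt (c : ℝ≥0 → ℕ) (t : ℝ≥0) : Prop :=
  0 < t ∧ ∀ s, s < t → c s < c t

/-- The deterministic dynamics of the smoothing process with transition matrix `p`, driven by the
clocks `c k`: when clock `k` rings at time `t`, the value at `k` becomes the `p k`-weighted
average of the values just before time `t`; the value at a site stays unchanged as long as its own
clock does not ring. -/
structure IsSmoothingPath {ι : Type*} [Fintype ι] (p : Matrix ι ι ℝ) (c : ι → ℝ≥0 → ℕ)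
    (Y : ℝ≥0 → ι → ℝ) : Prop where
  update : ∀ k t, RingsAt (c k) t →
    Y t k = ∑ j, p k j * Function.leftLim (fun s => Y s j) t
  unchanged : ∀ k s t, s ≤ t → c k s = c k t → Y s k = Y t k

/-- `Y` is a smoothing process with transition matrix `p` and (possibly random) initial
configuration `Y 0`, driven by jointly independent rate one Poisson clocks `N k`, one for each
site, which are independent of `Y 0`. -/
structure IsSmoothingProcess {ι Ω : Type*} [Fintype ι] [MeasurableSpace Ω] (p : Matrix ι ι ℝ)
    (N : ι → ℝ≥0 → Ω → ℕ) (Y : ℝ≥0 → Ω → ι → ℝ) (P : Measure Ω) : Prop where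
  measurable_init : Measurable (Y 0)
  poisson : ∀ k, IsUnitPoissonProcess (N k) P
  indep_clocks : iIndepFun (fun k ω t => N k t ω) P
  indep_init : IndepFun (Y 0) (fun ω k t => N k t ω) P
  path : ∀ᵐ ω ∂P, IsSmoothingPath p (fun k t => N k t ω) (fun t => Y t ω)

/-- The discrete torus `(ℤ/nℤ)^d`. -/
abbrev Torus (d n : ℕ) : Type := Fin d → ZMod n

/-- The nearest neighbour graph on the torus: two distinct sites are adjacent when they differ by
plus or minus a unit vector. -/
def torusGraph (d n : ℕ) : SimpleGraph (Torus d n) :=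
  SimpleGraph.circulantGraph (Set.range fun k : Fin d => Pi.single k (1 : ZMod n))

open Classical in
/-- The transition matrix of the simple random walk on the torus (every site has `2 * d`
neighbours when `3 ≤ n`). -/
noncomputable def torusWalk (d n : ℕ) : Matrix (Torus d n) (Torus d n) ℝ :=
  fun i j => if (torusGraph d n).Adj i j then 1 / (2 * (d : ℝ)) else 0

/-- The spectral gap `1 - cos (2π/n)` of the simple random walk on the cycle `ℤ/nℤ`. -/
noncomputable def cycleGap (n : ℕ) : ℝ := 1 - Real.cos (2 * Real.pi / n)

/-- The average `n^{-d} ∑ i, y i` of a configuration on the torus. -/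
noncomputable def torusAvg {d n : ℕ} [NeZero n] (y : Torus d n → ℝ) : ℝ :=
  ((n : ℝ) ^ d)⁻¹ * ∑ i, y i

/-- The limit as `t → ∞` of the average of a path of configurations (when it exists). -/
noncomputable def torusAvgLimit {d n : ℕ} [NeZero n] (Y : ℝ≥0 → Torus d n → ℝ) : ℝ :=
  limUnder atTop fun t => torusAvg (Y t)

/-- `m` is a median of the finite family `y` (counted with multiplicity): at least half of the
values are `≤ m` and at least half of them are `≥ m`. For a family of odd size it is unique. -/
def IsMedian {ι : Type*} [Fintype ι] (y : ι → ℝ) (m : ℝ) : Prop :=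
  Nat.card ι ≤ 2 * Nat.card {i // y i ≤ m} ∧ Nat.card ι ≤ 2 * Nat.card {i // m ≤ y i}

/-! The walk is doubly stochastic, so S = Σ_i Y_i is a martingale: a ring at k adds v_k = ((P -
1)Y)_k, and Σ_k v_k = 0. The mean square increment of S over a time interval is therefore the
integral of E D, where D = Σ_k v_k² is the `dissipation`, and the task is to bound E D.

The characters diagonalise P. The second moment of each Fourier coefficient decays at rate 2λ_k and
receives the source E D, the same for every k because characters have modulus 1
(`chainOp_normSq_torusFourier`). Since D = n^{-d} Σ λ_k² |ŷ_k|², E D solves a renewal equation with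
kernel K(u) = n^{-d} Σ λ_k² e^{-2λ_k u} and forcing at most (Σ|y_i|)² K. D ignores additive
constants, so |y_i| may be replaced by |y_i - c| for any c, such as the median.

K has mass n^{-d} Σ λ_k/2 = 1/2, because P has trace 0. Tilt it by e^{θu}, θ = 2γ - δ, with γ the
spectral gap. The at most 5^d modes with λ_k < 2γ then weigh at most of order n^{-d} γ²/δ; as γ is
of order n^{-2}, a δ of order n^{-(d+4)} keeps the mass below 3/4 (`sum_torusKernel_le`). The tilted
kernel is O((1+u)^{-(d+4)/2} + n^{-(d+4)}) (`torusKernel_le`), and a renewal equation of mass below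
1 passes this profile to its solution (`renewal_le`). Integrating over [t,∞) costs one power of 1+t
in the first term and a factor 1/θ = O(n²) in the second (`chainOp_pow_increment_le`).

All this is done in discrete time. On fine dyadic grids the process almost surely agrees with a
chain that applies at most one ring per cell; expectations of the chain are finite sums, namely
powers of `chainOp`, and Fatou transfers the bounds (`lintegral_smoothing_le_liminf`). The limit
exists because D tends to 0 along the integers, the gap turns this into small oscillation, and
averaging never enlarges the range of values (`ae_tendsto_torusAvg`). -/

section SmoothingPath

/-! ### Deterministic paths and their reduction to words of rings. -/

variable {ι : Type*} [Fintype ι] [DecidableEq ι]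

/-- The configuration after the clock at `k` has rung. -/
def siteUpdate (p : Matrix ι ι ℝ) (k : ι) (y : ι → ℝ) : ι → ℝ :=
  Function.update y k (∑ j, p k j * y j)

/-- The effect of at most one ring on a configuration. -/
def ringUpdate (p : Matrix ι ι ℝ) : Option ι → (ι → ℝ) → ι → ℝ
  | none, y => y
  | some k, y => siteUpdate p k y

/-- The configurations produced by a sequence of rings. -/
def ringChain (p : Matrix ι ι ℝ) (J : ℕ → Option ι) (y : ι → ℝ) : ℕ → ι → ℝ
  | 0 => y
  | j + 1 => ringUpdate p (J j) (ringChain p J y j)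

open Classical in
/-- The site of the only ring, if the clock increments `x` consist of one ring. -/
noncomputable def soleRing (x : ι → ℕ) : Option ι :=
  if h : ∃ k, x = Pi.single k 1 then some h.choose else none

theorem soleRing_zero : soleRing (0 : ι → ℕ) = none := by
  rw [soleRing, dif_neg]
  rintro ⟨k, hk⟩
  simpa using congrFun hk k

theorem soleRing_eq_some_iff (x : ι → ℕ) (k : ι) :
    soleRing x = some k ↔ x = Pi.single k 1 := by
  have inj : ∀ a b : ι, (Pi.single a 1 : ι → ℕ) = Pi.single b 1 → a = b := by
    intro a b hab
    by_contra hne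
    have := congrFun hab a
    simp [hne] at this
  rw [soleRing]
  split_ifs with h
  · have := h.choose_spec
    constructor
    · intro hk
      rw [← Option.some.inj hk]
      exact this
    · intro hk
      rw [inj _ _ (this.symm.trans hk)]
  · simp only [false_iff]
    exact fun hk => h ⟨k, hk⟩

/-- The clock increments `x` contain at most one ring. -/
def AtMostOneRing (x : ι → ℕ) : Prop := x = 0 ∨ ∃ k, x = Pi.single k 1

/-- The ring is at the infimum of the times where `c` has reached its final level; right-continuity
makes the infimum attained. -/
theorem exists_ring_time {c : ℝ≥0 → ℕ} (hc : Monotone c)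
    (hr : ∀ t, ContinuousWithinAt c (Set.Ici t) t) {u v : ℝ≥0}
    (h : c v = c u + 1) :
    ∃ τ, u < τ ∧ τ ≤ v ∧ (∀ s, u ≤ s → s < τ → c s = c u) ∧
      (∀ s, τ ≤ s → s ≤ v → c s = c v) ∧ RingsAt c τ := by
  set S : Set ℝ≥0 := {s | c v ≤ c s} with hS
  have hvS : v ∈ S := le_refl (c v)
  set τ := sInf S with hτ
  have hτv : τ ≤ v := csInf_le' hvS
  have hmem : τ ∈ S := by
    have h1 : ∀ᶠ s in 𝓝[Set.Ici τ] τ, c s = c τ := by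
      have := (hr τ).eventually (show ∀ᶠ m in 𝓝 (c τ), m = c τ by simp)
      exact this
    obtain ⟨w, hw, hw'⟩ := (mem_nhdsGE_iff_exists_Ico_subset' (show τ < τ + 1 by simp)).1 h1
    obtain ⟨s, hsS, hsw⟩ := exists_lt_of_csInf_lt ⟨v, hvS⟩ (show sInf S < w from hw)
    have h2 : c s = c τ := hw' ⟨csInf_le' hsS, hsw⟩
    exact (show c v ≤ c s from hsS).trans_eq h2
  have hlt : ∀ s, s < τ → c s < c v := fun s hs => by
    by_contra hcon
    exact absurd (csInf_le' (show s ∈ S from not_lt.1 hcon)) (not_le.2 hs)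
  have huτ : u < τ := by
    by_contra hcon
    have := hc (not_lt.1 hcon)
    have h3 : c v ≤ c τ := hmem
    omega
  refine ⟨τ, huτ, hτv, fun s hus hs => ?_, fun s hs hsv => ?_, ⟨pos_of_gt huτ, fun s hs => ?_⟩⟩
  · have := hlt s hs
    have := hc hus
    omega
  · exact le_antisymm (hc hsv) (le_trans hmem (hc hs))
  · exact lt_of_lt_of_le (hlt s hs) hmem

variable {p : Matrix ι ι ℝ} {c : ι → ℝ≥0 → ℕ} {Y : ℝ≥0 → ι → ℝ}

theorem IsSmoothingPath.eq_of_no_ring (h : IsSmoothingPath p c Y) (hc : ∀ k, Monotone (c k))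
    {u v s : ℝ≥0} (hx : (fun k => c k v - c k u) = 0) (hus : u ≤ s) (hsv : s ≤ v) :
    Y s = Y u := by
  funext k
  have h0 : c k v - c k u = 0 := congrFun hx k
  have h1 := hc k hus
  have h2 := hc k hsv
  exact (h.unchanged k u s hus (by omega)).symm

/-- The path is constant on [u, τ), so the left limits in the update rule are the values of `Y u`.
-/
theorem IsSmoothingPath.exists_of_sole_ring (h : IsSmoothingPath p c Y)
    (hc : ∀ k, Monotone (c k)) (hr : ∀ k t, ContinuousWithinAt (c k) (Set.Ici t) t)
    {u v : ℝ≥0} {k : ι} (huv : u ≤ v) (hx : (fun k => c k v - c k u) = Pi.single k 1) :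
    ∃ τ, u < τ ∧ τ ≤ v ∧ (∀ s, u ≤ s → s < τ → Y s = Y u) ∧
      (∀ s, τ ≤ s → s ≤ v → Y s = siteUpdate p k (Y u)) := by
  have hk : c k v = c k u + 1 := by
    have h0 : c k v - c k u = 1 := by simpa using congrFun hx k
    have := hc k huv
    omega
  have hne : ∀ i, i ≠ k → ∀ s, u ≤ s → s ≤ v → Y s i = Y u i := by
    intro i hi s hus hsv
    have h0 : c i v - c i u = 0 := by simpa [hi] using congrFun hx i
    have h1 := hc i hus
    have h2 := hc i hsv
    exact (h.unchanged i u s hus (by omega)).symm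
  obtain ⟨τ, huτ, hτv, hbefore, hafter, hring⟩ := exists_ring_time (hc k) (hr k) hk
  have hY : ∀ s, u ≤ s → s < τ → Y s = Y u := by
    intro s hus hs
    funext i
    by_cases hi : i = k
    · subst hi
      exact (h.unchanged i u s hus (hbefore s hus hs).symm).symm
    · exact hne i hi s hus (hs.le.trans hτv)
  refine ⟨τ, huτ, hτv, hY, fun s hs hsv => ?_⟩
  funext i
  by_cases hi : i = k
  · subst hi
    rw [← h.unchanged i τ s hs ((hafter τ le_rfl hτv).trans (hafter s hs hsv).symm),
      h.update i τ hring, siteUpdate, Function.update_self]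
    refine Finset.sum_congr rfl fun j _ => ?_
    congr 1
    have : (𝓝[<] τ).NeBot := nhdsLT_neBot_of_exists_lt ⟨u, huτ⟩
    refine leftLim_eq_of_tendsto (tendsto_const_nhds.congr' ?_)
    filter_upwards [Ico_mem_nhdsLT huτ] with w hw
    rw [hY w hw.1 hw.2]
  · rw [hne i hi s (huτ.le.trans hs) hsv, siteUpdate, Function.update_of_ne hi]

/-- Every interval that contains the values of `y` contains those of `z`. -/
def HullLE (z y : ι → ℝ) : Prop :=
  ∀ a b : ℝ, (∀ i, y i ∈ Set.Icc a b) → ∀ i, z i ∈ Set.Icc a b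

theorem HullLE.refl (y : ι → ℝ) : HullLE y y := fun _ _ h => h

theorem HullLE.trans {x y z : ι → ℝ} (h1 : HullLE x y) (h2 : HullLE y z) : HullLE x z :=
  fun a b h => h1 a b (h2 a b h)

theorem hullLE_siteUpdate (hp : ∀ i j, 0 ≤ p i j) (hp1 : ∀ i, ∑ j, p i j = 1) (k : ι)
    (y : ι → ℝ) : HullLE (siteUpdate p k y) y := by
  intro a b h i
  by_cases hi : i = k
  · subst hi
    rw [siteUpdate, Function.update_self]
    constructor
    · calc a = ∑ j, p i j * a := by rw [← Finset.sum_mul, hp1, one_mul]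
        _ ≤ _ := Finset.sum_le_sum fun j _ => mul_le_mul_of_nonneg_left (h j).1 (hp i j)
    · calc _ ≤ ∑ j, p i j * b :=
            Finset.sum_le_sum fun j _ => mul_le_mul_of_nonneg_left (h j).2 (hp i j)
        _ = b := by rw [← Finset.sum_mul, hp1, one_mul]
  · rw [siteUpdate, Function.update_of_ne hi]
    exact h i

theorem IsSmoothingPath.eq_ringUpdate (h : IsSmoothingPath p c Y)
    (hc : ∀ k, Monotone (c k)) (hr : ∀ k t, ContinuousWithinAt (c k) (Set.Ici t) t)
    {u v : ℝ≥0} (huv : u ≤ v) (hx : AtMostOneRing fun k => c k v - c k u) :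
    Y v = ringUpdate p (soleRing fun k => c k v - c k u) (Y u) := by
  rcases hx with hx | ⟨k, hx⟩
  · rw [hx, soleRing_zero]
    exact h.eq_of_no_ring hc hx huv le_rfl
  · rw [(soleRing_eq_some_iff _ k).2 hx]
    obtain ⟨τ, -, hτv, -, h2⟩ := h.exists_of_sole_ring hc hr huv hx
    exact h2 v hτv le_rfl

theorem IsSmoothingPath.hullLE_of_atMostOneRing (h : IsSmoothingPath p c Y)
    (hc : ∀ k, Monotone (c k)) (hr : ∀ k t, ContinuousWithinAt (c k) (Set.Ici t) t)
    (hp : ∀ i j, 0 ≤ p i j) (hp1 : ∀ i, ∑ j, p i j = 1)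
    {u v : ℝ≥0} (huv : u ≤ v) (hx : AtMostOneRing fun k => c k v - c k u)
    {s s' : ℝ≥0} (hus : u ≤ s) (hss : s ≤ s') (hsv : s' ≤ v) : HullLE (Y s') (Y s) := by
  rcases hx with hx | ⟨k, hx⟩
  · rw [h.eq_of_no_ring hc hx hus (hss.trans hsv), h.eq_of_no_ring hc hx (hus.trans hss) hsv]
    exact HullLE.refl _
  · obtain ⟨τ, -, hτv, h1, h2⟩ := h.exists_of_sole_ring hc hr huv hx
    rcases lt_or_ge s' τ with h3 | h3
    · rw [h1 s' (hus.trans hss) h3, h1 s hus (hss.trans_lt h3)]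
      exact HullLE.refl _
    · rw [h2 s' h3 hsv]
      rcases lt_or_ge s τ with h4 | h4
      · rw [h1 s hus h4]
        exact hullLE_siteUpdate hp hp1 k _
      · rw [h2 s h4 (hss.trans hsv)]
        exact HullLE.refl _

/-- The clock increments over the `j`-th cell of the grid with mesh `ε`. -/
def cellIncrement (c : ι → ℝ≥0 → ℕ) (ε : ℝ≥0) (j : ℕ) (k : ι) : ℕ :=
  c k ((j + 1 : ℕ) * ε) - c k (j * ε)

theorem IsSmoothingPath.eq_ringChain (h : IsSmoothingPath p c Y)
    (hc : ∀ k, Monotone (c k)) (hr : ∀ k t, ContinuousWithinAt (c k) (Set.Ici t) t)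
    (ε : ℝ≥0) (b : ℕ) (hx : ∀ j < b, AtMostOneRing (cellIncrement c ε j)) :
    ∀ j ≤ b, Y (j * ε) = ringChain p (fun j => soleRing (cellIncrement c ε j)) (Y 0) j := by
  intro j
  induction j with
  | zero => simp [ringChain]
  | succ j ih =>
    intro hj
    rw [ringChain, ← ih (by omega)]
    refine h.eq_ringUpdate hc hr ?_ (hx j (by omega))
    gcongr
    exact_mod_cast Nat.le_succ j

/-- Times between grid points are included: the limit of the average runs over all real times, while
the dissipation will be controlled at integers only. -/
theorem IsSmoothingPath.hullLE_of_grid (h : IsSmoothingPath p c Y)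
    (hc : ∀ k, Monotone (c k)) (hr : ∀ k t, ContinuousWithinAt (c k) (Set.Ici t) t)
    (hp : ∀ i j, 0 ≤ p i j) (hp1 : ∀ i, ∑ j, p i j = 1)
    (ε : ℝ≥0) (b : ℕ) (hx : ∀ j < b, AtMostOneRing (cellIncrement c ε j)) :
    ∀ s s' : ℝ≥0, s ≤ s' → s' ≤ b * ε → HullLE (Y s') (Y s) := by
  induction b with
  | zero =>
    intro s s' hs hs'
    have h1 : s' = 0 := by simpa using hs'
    have h2 : s = s' := le_antisymm hs (h1 ▸ zero_le)
    rw [h2]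
    exact HullLE.refl _
  | succ b ih =>
    have ih := ih fun j hj => hx j (by omega)
    have hcell : ∀ s s' : ℝ≥0, b * ε ≤ s → s ≤ s' → s' ≤ (b + 1 : ℕ) * ε → HullLE (Y s') (Y s) :=
      fun s s' h1 h2 h3 => h.hullLE_of_atMostOneRing hc hr hp hp1 (h1.trans (h2.trans h3))
        (hx b (by omega)) h1 h2 h3
    intro s s' hs hs'
    rcases le_total s' (b * ε) with h1 | h1
    · exact ih s s' hs h1
    · rcases le_total s (b * ε) with h2 | h2
      · exact (hcell _ s' le_rfl h1 hs').trans (ih s _ h2 le_rfl)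
      · exact hcell s s' h2 hs hs'

end SmoothingPath

/-- Independence is a product form of the joint law, and currying carries the product over pairs to
a product of products over rows. -/
theorem iIndepFun_curry {Ω ι κ : Type*} {E : Type*} [MeasurableSpace Ω] [MeasurableSpace E]
    {P : Measure Ω} {X : κ → ι → Ω → E} (mX : ∀ i j, Measurable (X i j))
    (h : iIndepFun (fun (z : κ × ι) ω => X z.1 z.2 ω) P) :
    iIndepFun (fun i ω j => X i j ω) P := by
  have := h.isProbabilityMeasure
  have : ∀ i j, IsProbabilityMeasure (P.map (X i j)) :=
    fun i j => Measure.isProbabilityMeasure_map (mX i j).aemeasurable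
  rw [iIndepFun_iff_map_fun_eq_infinitePi_map (by fun_prop)]
  have h1 : (fun ω i j => X i j ω) =
      (MeasurableEquiv.curry κ ι E) ∘ (fun ω (z : κ × ι) => X z.1 z.2 ω) := rfl
  rw [h1, ← Measure.map_map (by fun_prop) (by fun_prop),
    (iIndepFun_iff_map_fun_eq_infinitePi_map (by fun_prop)).1 h,
    Measure.infinitePi_map_curry (fun i j => P.map (X i j))]
  congr 1
  funext i
  have h2 : iIndepFun (fun j ω => X i j ω) P :=
    h.precomp (g := fun j => (i, j)) fun a b hab => (Prod.mk.inj hab).2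
  rw [← (iIndepFun_iff_map_fun_eq_infinitePi_map (by fun_prop)).1 h2]

/-! ### The law of the rings in the cells of a grid. -/

section Clocks

variable {ι Ω : Type*} [Fintype ι] [DecidableEq ι] [MeasurableSpace Ω] {P : Measure Ω}
  [IsProbabilityMeasure P] {p : Matrix ι ι ℝ} {N : ι → ℝ≥0 → Ω → ℕ} {Y : ℝ≥0 → Ω → ι → ℝ}

/-- The probability that a given clock is the only one to ring, and rings once, in a cell of
length `ε`. -/
noncomputable def ringProb (ι : Type*) [Fintype ι] (ε : ℝ≥0) : ℝ :=
  ε * Real.exp (-(Fintype.card ι * ε))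

/-- The law of `soleRing` for a cell, in terms of the probability `q` of each site. -/
def ringWeight (q : ℝ) : Option ι → ℝ
  | none => 1 - Fintype.card ι * q
  | some _ => q

theorem measurable_cellIncrement (ε : ℝ≥0) (j : ℕ) :
    Measurable fun c : ι → ℝ≥0 → ℕ => cellIncrement c ε j := by
  refine measurable_pi_lambda _ fun k => ?_
  unfold cellIncrement
  fun_prop

theorem measurable_clocks (hS : IsSmoothingProcess p N Y P) :
    Measurable fun ω k t => N k t ω :=
  measurable_pi_lambda _ fun k => measurable_pi_lambda _ fun t => (hS.poisson k).measurable t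

/-- Independent clocks with independent increments make all (clock, cell) pairs independent;
regrouping them by cell gives the claim. -/
theorem iIndepFun_cellIncrement (hS : IsSmoothingProcess p N Y P) (ε : ℝ≥0) :
    iIndepFun (fun j ω => cellIncrement (fun k t => N k t ω) ε j) P := by
  have hm : ∀ k t, Measurable (N k t) := fun k => (hS.poisson k).measurable
  have h1 : iIndepFun (fun (z : ι × ℕ) ω => cellIncrement (fun k t => N k t ω) ε z.2 z.1) P := by
    refine iIndepFun_uncurry' (X := fun k j ω => cellIncrement (fun k t => N k t ω) ε j k) ?_ ?_ ?_
    · intro k j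
      exact (hm _ _).sub (hm _ _)
    · refine hS.indep_clocks.comp (fun k c j => c ((j + 1 : ℕ) * ε) - c (j * ε)) fun k => ?_
      fun_prop
    · intro k
      refine (hS.poisson k).indepIncrements.nat (t := fun j : ℕ => j * ε) fun a b hab => ?_
      dsimp only
      gcongr
  refine iIndepFun_curry (X := fun j k ω => cellIncrement (fun k t => N k t ω) ε j k) ?_ ?_
  · intro k j
    exact (hm _ _).sub (hm _ _)
  · exact h1.precomp Prod.swap_injective

theorem measure_cellIncrement_eq (hS : IsSmoothingProcess p N Y P) (ε : ℝ≥0) (j : ℕ)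
    (x : ι → ℕ) :
    P {ω | cellIncrement (fun k t => N k t ω) ε j = x} = ∏ k, poissonMeasure ε {x k} := by
  have hind : iIndepFun (fun k ω => cellIncrement (fun k t => N k t ω) ε j k) P := by
    refine hS.indep_clocks.comp (fun k c => c ((j + 1 : ℕ) * ε) - c (j * ε)) fun k => ?_
    fun_prop
  have hset : {ω | cellIncrement (fun k t => N k t ω) ε j = x} =
      ⋂ k, {ω | cellIncrement (fun k t => N k t ω) ε j k = x k} := by
    ext ω
    simp [funext_iff]
  rw [hset, hind.meas_iInter (s := fun k =>
    {ω | cellIncrement (fun k t => N k t ω) ε j k = x k}) fun k => ⟨{x k}, .of_discrete, rfl⟩]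
  refine Finset.prod_congr rfl fun k _ => ?_
  have hle : (j : ℝ≥0) * ε ≤ (j + 1 : ℕ) * ε := by
    gcongr
    exact_mod_cast Nat.le_succ j
  have hlaw := (hS.poisson k).increment_law _ _ hle
  have hsub : ((j + 1 : ℕ) : ℝ≥0) * ε - j * ε = ε := by
    push_cast
    rw [add_mul, one_mul, add_tsub_cancel_left]
  rw [hsub] at hlaw
  rw [← hlaw.map_eq, Measure.map_apply_of_aemeasurable hlaw.aemeasurable .of_discrete]
  rfl

theorem measure_cellIncrement_eq_zero (hS : IsSmoothingProcess p N Y P) (ε : ℝ≥0) (j : ℕ) :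
    P {ω | cellIncrement (fun k t => N k t ω) ε j = 0} =
      ENNReal.ofReal (Real.exp (-(Fintype.card ι * ε))) := by
  rw [measure_cellIncrement_eq hS, Finset.prod_congr rfl fun k _ => poissonMeasure_singleton ε _]
  simp only [Pi.zero_apply, pow_zero, mul_one, Nat.factorial_zero, Nat.cast_one, div_one,
    Finset.prod_const, Finset.card_univ]
  rw [← ENNReal.ofReal_pow (Real.exp_nonneg _), ← Real.exp_nat_mul]
  ring_nf

theorem measure_cellIncrement_eq_single (hS : IsSmoothingProcess p N Y P) (ε : ℝ≥0) (j : ℕ)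
    (k : ι) :
    P {ω | cellIncrement (fun k t => N k t ω) ε j = Pi.single k 1} =
      ENNReal.ofReal (ringProb ι ε) := by
  rw [measure_cellIncrement_eq hS, Finset.prod_congr rfl fun k _ => poissonMeasure_singleton ε _,
    ← ENNReal.ofReal_prod_of_nonneg fun i _ => by positivity]
  congr 1
  have h : ∀ i, Real.exp (-(ε : ℝ)) * (ε : ℝ) ^ ((Pi.single k 1 : ι → ℕ) i) /
      (((Pi.single k 1 : ι → ℕ) i).factorial : ℝ) =
      Real.exp (-(ε : ℝ)) * (if i = k then (ε : ℝ) else 1) := by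
    intro i
    by_cases hi : i = k
    · subst hi
      simp
    · simp [hi]
  rw [Finset.prod_congr rfl fun i _ => h i, Finset.prod_mul_distrib]
  simp only [Finset.prod_const, Finset.card_univ, Finset.prod_ite_eq', Finset.mem_univ, if_true]
  rw [← Real.exp_nat_mul, ringProb]
  ring_nf

theorem ringProb_nonneg (ε : ℝ≥0) : 0 ≤ ringProb ι ε := by
  unfold ringProb
  positivity

theorem card_mul_ringProb_le_one (ε : ℝ≥0) : Fintype.card ι * ringProb ι ε ≤ 1 := by
  have h := Real.add_one_le_exp ((Fintype.card ι : ℝ) * ε)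
  have h2 := Real.exp_pos ((Fintype.card ι : ℝ) * ε)
  rw [ringProb, Real.exp_neg, ← mul_assoc, ← div_eq_mul_inv, div_le_one h2]
  linarith

theorem ringWeight_nonneg {q : ℝ} (hq : 0 ≤ q) (hq1 : Fintype.card ι * q ≤ 1) (o : Option ι) :
    0 ≤ ringWeight q o := by
  cases o with
  | none => simpa [ringWeight] using hq1
  | some k => exact hq

/-- The value `none` covers cells without rings and cells with several, hence its weight is the
complement of the site weights. -/
theorem measure_soleRing_eq (hS : IsSmoothingProcess p N Y P) (ε : ℝ≥0) (j : ℕ)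
    (o : Option ι) :
    P {ω | soleRing (cellIncrement (fun k t => N k t ω) ε j) = o} =
      ENNReal.ofReal (ringWeight (ringProb ι ε) o) := by
  have hmeas : ∀ s : Set (ι → ℕ), MeasurableSet
      {ω | cellIncrement (fun k t => N k t ω) ε j ∈ s} := fun s =>
    ((measurable_cellIncrement ε j).comp (measurable_clocks hS)) .of_discrete
  have hsome : ∀ k : ι, P {ω | soleRing (cellIncrement (fun k t => N k t ω) ε j) = some k} =
      ENNReal.ofReal (ringProb ι ε) := by
    intro k
    simp_rw [soleRing_eq_some_iff]
    exact measure_cellIncrement_eq_single hS ε j k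
  cases o with
  | some k => exact hsome k
  | none =>
    have hcompl : {ω | soleRing (cellIncrement (fun k t => N k t ω) ε j) = none} =
        (⋃ k : ι, {ω | soleRing (cellIncrement (fun k t => N k t ω) ε j) = some k})ᶜ := by
      ext ω
      simp only [Set.mem_setOf_eq, Set.mem_compl_iff, Set.mem_iUnion, not_exists]
      exact Option.eq_none_iff_forall_ne_some
    have hm : ∀ k : ι, MeasurableSet
        {ω | soleRing (cellIncrement (fun k t => N k t ω) ε j) = some k} :=
      fun k => hmeas {x | soleRing x = some k}
    rw [hcompl, measure_compl (MeasurableSet.iUnion hm) (measure_ne_top _ _),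
      measure_iUnion _ hm]
    · rw [tsum_fintype, Finset.sum_congr rfl fun k _ => hsome k, Finset.sum_const,
        Finset.card_univ, nsmul_eq_mul, measure_univ, ringWeight,
        ENNReal.ofReal_sub _ (mul_nonneg (Nat.cast_nonneg _) (ringProb_nonneg ε)),
        ENNReal.ofReal_mul (Nat.cast_nonneg _), ENNReal.ofReal_one, ENNReal.ofReal_natCast]
    · intro a b hab
      refine Set.disjoint_left.2 fun ω h1 h2 => hab ?_
      exact Option.some.inj ((Eq.symm h1).trans h2)

theorem measure_not_atMostOneRing_le (hS : IsSmoothingProcess p N Y P) (ε : ℝ≥0) (j : ℕ) :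
    P {ω | ¬ AtMostOneRing (cellIncrement (fun k t => N k t ω) ε j)} ≤
      ENNReal.ofReal ((Fintype.card ι * ε) ^ 2) := by
  have hmeas : ∀ s : Set (ι → ℕ), MeasurableSet
      {ω | cellIncrement (fun k t => N k t ω) ε j ∈ s} := fun s =>
    ((measurable_cellIncrement ε j).comp (measurable_clocks hS)) .of_discrete
  have hsub : {ω | ¬ AtMostOneRing (cellIncrement (fun k t => N k t ω) ε j)} =
      {ω | soleRing (cellIncrement (fun k t => N k t ω) ε j) = none} \
        {ω | cellIncrement (fun k t => N k t ω) ε j = 0} := by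
    ext ω
    simp only [Set.mem_setOf_eq, Set.mem_diff, AtMostOneRing, not_or, not_exists,
      Option.eq_none_iff_forall_ne_some, ne_eq, soleRing_eq_some_iff]
    tauto
  have hin : {ω | cellIncrement (fun k t => N k t ω) ε j = 0} ⊆
      {ω | soleRing (cellIncrement (fun k t => N k t ω) ε j) = none} := by
    intro ω hω
    simp only [Set.mem_setOf_eq] at hω ⊢
    rw [hω, soleRing_zero]
  rw [hsub, measure_diff hin (hmeas {0}).nullMeasurableSet (measure_ne_top _ _),
    measure_soleRing_eq hS, measure_cellIncrement_eq_zero hS,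
    ← ENNReal.ofReal_sub _ (Real.exp_nonneg _)]
  refine ENNReal.ofReal_le_ofReal ?_
  rw [ringWeight, ringProb]
  set x : ℝ := Fintype.card ι * ε with hx
  have hx0 : 0 ≤ x := by positivity
  have h := Real.add_one_le_exp (-x)
  have h2 : (Fintype.card ι : ℝ) * (ε * Real.exp (-x)) = x * Real.exp (-x) := by rw [hx]; ring
  rw [h2]
  -- With x = card · ε the claim is 1 - (1 + x)e^{-x} ≤ x², which follows from e^{-x} ≥ 1 - x.
  nlinarith

theorem measure_soleRing_word (hS : IsSmoothingProcess p N Y P) (ε : ℝ≥0) (b : ℕ)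
    (w : Fin b → Option ι) :
    P {ω | ∀ j : Fin b, soleRing (cellIncrement (fun k t => N k t ω) ε j) = w j} =
      ENNReal.ofReal (∏ j, ringWeight (ringProb ι ε) (w j)) := by
  have hset : {ω | ∀ j : Fin b, soleRing (cellIncrement (fun k t => N k t ω) ε j) = w j} =
      ⋂ j : Fin b, {ω | soleRing (cellIncrement (fun k t => N k t ω) ε j) = w j} := by
    ext ω
    simp
  have hind := (iIndepFun_cellIncrement hS ε).precomp (Fin.val_injective (n := b))
  rw [hset, hind.meas_iInter (s := fun j : Fin b =>
      {ω | soleRing (cellIncrement (fun k t => N k t ω) ε j) = w j})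
      fun j => ⟨{x | soleRing x = w j}, .of_discrete, rfl⟩,
    ENNReal.ofReal_prod_of_nonneg fun j _ =>
      ringWeight_nonneg (ringProb_nonneg ε) (card_mul_ringProb_le_one ε) _]
  exact Finset.prod_congr rfl fun j _ => measure_soleRing_eq hS ε j (w j)

/-- The clocks are independent of `Y 0` and there are finitely many words, so the randomness of the
rings integrates out with no integrability assumption on the initial configuration. -/
theorem lintegral_soleRing_word (hS : IsSmoothingProcess p N Y P) (ε : ℝ≥0) (b : ℕ)
    (G : (Fin b → Option ι) → (ι → ℝ) → ℝ≥0∞) (hG : ∀ w, Measurable (G w)) :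
    ∫⁻ ω, G (fun j => soleRing (cellIncrement (fun k t => N k t ω) ε j)) (Y 0 ω) ∂P =
      ∫⁻ ω, ∑ w, ENNReal.ofReal (∏ j, ringWeight (ringProb ι ε) (w j)) * G w (Y 0 ω) ∂P := by
  classical
  set A : (Fin b → Option ι) → Set (ι → ℝ≥0 → ℕ) := fun w =>
    {c | ∀ j : Fin b, soleRing (cellIncrement c ε j) = w j} with hA
  have hAm : ∀ w, MeasurableSet (A w) := by
    intro w
    have : A w = ⋂ j : Fin b, (fun c => cellIncrement c ε j) ⁻¹' {x | soleRing x = w j} := by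
      ext c
      simp [hA]
    rw [this]
    exact MeasurableSet.iInter fun j => measurable_cellIncrement ε j .of_discrete
  have hGm : ∀ w, Measurable fun ω => G w (Y 0 ω) := fun w => (hG w).comp hS.measurable_init
  have hpt : ∀ ω, G (fun j => soleRing (cellIncrement (fun k t => N k t ω) ε j)) (Y 0 ω) =
      ∑ w, (A w).indicator 1 (fun k t => N k t ω) * G w (Y 0 ω) := by
    intro ω
    rw [Finset.sum_eq_single fun j : Fin b => soleRing (cellIncrement (fun k t => N k t ω) ε j)]
    · rw [Set.indicator_of_mem]
      · simp
      · exact fun j => rfl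
    · intro w _ hw
      rw [Set.indicator_of_notMem, zero_mul]
      exact fun h => hw (funext fun j => (h j).symm)
    · simp
  simp_rw [hpt]
  have hIm : ∀ w, Measurable fun ω => (A w).indicator (1 : (ι → ℝ≥0 → ℕ) → ℝ≥0∞) (fun k t => N k t ω) :=
    fun w => (measurable_one.indicator (hAm w)).comp (measurable_clocks hS)
  rw [lintegral_finsetSum (f := fun w ω => (A w).indicator (1 : (ι → ℝ≥0 → ℕ) → ℝ≥0∞)
      (fun k t => N k t ω) * G w (Y 0 ω)) _ fun w _ => (hIm w).mul (hGm w),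
    lintegral_finsetSum _ fun w _ => (hGm w).const_mul _]
  refine Finset.sum_congr rfl fun w _ => ?_
  rw [lintegral_const_mul _ (hGm w), ← measure_soleRing_word hS ε b w]
  have hind : IndepFun (fun ω => (A w).indicator (1 : (ι → ℝ≥0 → ℕ) → ℝ≥0∞) (fun k t => N k t ω))
      (fun ω => G w (Y 0 ω)) P :=
    hS.indep_init.symm.comp (measurable_one.indicator (hAm w)) (hG w)
  have := lintegral_mul_eq_lintegral_mul_lintegral_of_indepFun (hIm w) (hGm w) hind
  simp only [Pi.mul_apply] at this
  rw [this]
  congr 1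
  have h1 : (fun ω => (A w).indicator (1 : (ι → ℝ≥0 → ℕ) → ℝ≥0∞) (fun k t => N k t ω)) =
      ((fun ω k t => N k t ω) ⁻¹' A w).indicator 1 := by
    ext ω
    rfl
  rw [h1, lintegral_indicator_one (measurable_clocks hS (hAm w))]
  rfl

/-- Borel–Cantelli: 2^r l cells, each bad with probability O(4^{-r}), give a summable O(2^{-r}).
This is why the meshes are dyadic. -/
theorem ae_eventually_atMostOneRing (hS : IsSmoothingProcess p N Y P) (T : ℝ≥0) (l : ℕ) :
    ∀ᵐ ω ∂P, ∀ᶠ r : ℕ in atTop, ∀ j < 2 ^ r * l,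
      AtMostOneRing (cellIncrement (fun k t => N k t ω) (T / 2 ^ r) j) := by
  set C : ℝ := l * (Fintype.card ι * T) ^ 2 with hC
  have hbound : ∀ r : ℕ, P {ω | ∃ j < 2 ^ r * l,
      ¬ AtMostOneRing (cellIncrement (fun k t => N k t ω) (T / 2 ^ r) j)} ≤
      ENNReal.ofReal (C * (1 / 2) ^ r) := by
    intro r
    have hset : {ω | ∃ j < 2 ^ r * l,
        ¬ AtMostOneRing (cellIncrement (fun k t => N k t ω) (T / 2 ^ r) j)} =
        ⋃ j ∈ Finset.range (2 ^ r * l),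
          {ω | ¬ AtMostOneRing (cellIncrement (fun k t => N k t ω) (T / 2 ^ r) j)} := by
      ext ω
      simp
    rw [hset]
    refine (measure_biUnion_finset_le _ _).trans ?_
    refine (Finset.sum_le_sum fun j _ => measure_not_atMostOneRing_le hS _ j).trans ?_
    rw [Finset.sum_const, Finset.card_range, nsmul_eq_mul, ← ENNReal.ofReal_natCast,
      ← ENNReal.ofReal_mul (Nat.cast_nonneg _)]
    refine ENNReal.ofReal_le_ofReal (le_of_eq ?_)
    rw [hC]
    push_cast
    rw [one_div, inv_pow]
    field_simp
  have hsum : ∑' r : ℕ, P {ω | ∃ j < 2 ^ r * l,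
      ¬ AtMostOneRing (cellIncrement (fun k t => N k t ω) (T / 2 ^ r) j)} ≠ ∞ := by
    refine ne_top_of_le_ne_top ?_ (ENNReal.tsum_le_tsum hbound)
    exact (summable_geometric_two.mul_left C).tsum_ofReal_ne_top
  filter_upwards [ae_eventually_notMem hsum] with ω hω
  filter_upwards [hω] with r hr j hj
  by_contra hcon
  exact hr ⟨j, hj, hcon⟩

end Clocks

/-! ### The one-step operator of the discrete chain and the martingale identity. -/

section ChainOperator

variable {ι : Type*} [Fintype ι] [DecidableEq ι]

/-- The transition operator of the chain that updates each site with probability `q`. -/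
noncomputable def chainOp (p : Matrix ι ι ℝ) (q : ℝ) :
    ((ι → ℝ) → ℝ) →ₗ[ℝ] ((ι → ℝ) → ℝ) where
  toFun h y := ∑ o, ringWeight q o * h (ringUpdate p o y)
  map_add' h h' := by
    funext y
    simp [mul_add, Finset.sum_add_distrib]
  map_smul' c h := by
    funext y
    simp only [Pi.smul_apply, smul_eq_mul, RingHom.id_apply, Finset.mul_sum]
    exact Finset.sum_congr rfl fun o _ => by ring

theorem chainOp_apply (p : Matrix ι ι ℝ) (q : ℝ) (h : (ι → ℝ) → ℝ) (y : ι → ℝ) :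
    chainOp p q h y = ∑ o, ringWeight q o * h (ringUpdate p o y) := rfl

theorem chainOp_apply' (p : Matrix ι ι ℝ) (q : ℝ) (h : (ι → ℝ) → ℝ) (y : ι → ℝ) :
    chainOp p q h y = h y + q * ∑ k, (h (siteUpdate p k y) - h y) := by
  rw [chainOp_apply, Fintype.sum_option, Finset.sum_sub_distrib]
  simp only [ringWeight, ringUpdate, Finset.sum_const, Finset.card_univ, nsmul_eq_mul,
    ← Finset.mul_sum]
  ring

theorem chainOp_pow_nonneg (p : Matrix ι ι ℝ) {q : ℝ} (hq : 0 ≤ q)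
    (hq1 : Fintype.card ι * q ≤ 1) (j : ℕ) {h : (ι → ℝ) → ℝ} (hh : ∀ y, 0 ≤ h y) (y : ι → ℝ) :
    0 ≤ (chainOp p q ^ j) h y := by
  induction j generalizing h with
  | zero => exact hh y
  | succ j ih =>
    rw [pow_succ, Module.End.mul_apply]
    refine ih fun z => ?_
    rw [chainOp_apply]
    exact Finset.sum_nonneg fun o _ => mul_nonneg (ringWeight_nonneg hq hq1 o) (hh _)

/-- The infinite sequence of updates that starts with the finite word `w`. -/
def extendWord {b : ℕ} (w : Fin b → Option ι) (j : ℕ) : Option ι :=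
  if h : j < b then w ⟨j, h⟩ else none

theorem ringChain_congr (p : Matrix ι ι ℝ) {J J' : ℕ → Option ι} (y : ι → ℝ) {j : ℕ}
    (h : ∀ i < j, J i = J' i) : ringChain p J y j = ringChain p J' y j := by
  induction j with
  | zero => rfl
  | succ j ih => rw [ringChain, ringChain, h j (by omega), ih fun i hi => h i (by omega)]

theorem ringChain_extendWord (p : Matrix ι ι ℝ) (J : ℕ → Option ι) (y : ι → ℝ) {b j : ℕ}
    (hj : j ≤ b) :
    ringChain p (extendWord fun i : Fin b => J i) y j = ringChain p J y j := by
  refine ringChain_congr p y fun i hi => ?_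
  rw [extendWord, dif_pos (by omega)]

theorem ringChain_succ' (p : Matrix ι ι ℝ) (J : ℕ → Option ι) (y : ι → ℝ) (j : ℕ) :
    ringChain p J y (j + 1) = ringChain p (fun i => J (i + 1)) (ringUpdate p (J 0) y) j := by
  induction j with
  | zero => rfl
  | succ j ih => rw [ringChain, ih, ringChain]

theorem ringChain_extendWord_cons (p : Matrix ι ι ℝ) {b : ℕ} (o : Option ι)
    (w : Fin b → Option ι) (y : ι → ℝ) (j : ℕ) :
    ringChain p (extendWord (Fin.cons o w : Fin (b + 1) → Option ι)) y (j + 1) =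
      ringChain p (extendWord w) (ringUpdate p o y) j := by
  rw [ringChain_succ']
  have h0 : extendWord (Fin.cons o w : Fin (b + 1) → Option ι) 0 = o := by
    simp [extendWord]
  rw [h0]
  refine ringChain_congr p _ fun i _ => ?_
  simp only [extendWord, Nat.add_lt_add_iff_right]
  split_ifs with h
  · exact Fin.cons_succ (α := fun _ => Option ι) o w ⟨i, h⟩
  · rfl

theorem sum_word_succ {b : ℕ} (f : (Fin (b + 1) → Option ι) → ℝ) :
    ∑ w, f w = ∑ o, ∑ w : Fin b → Option ι, f (Fin.cons o w) := by
  rw [← Fintype.sum_prod_type']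
  exact (Fintype.sum_equiv (Fin.consEquiv fun _ => Option ι) _ _ fun x => rfl).symm

theorem sum_word_eq_chainOp_pow (p : Matrix ι ι ℝ) (q : ℝ) (h : (ι → ℝ) → ℝ) (b : ℕ)
    (y : ι → ℝ) :
    ∑ w : Fin b → Option ι, (∏ j, ringWeight q (w j)) * h (ringChain p (extendWord w) y b) =
      (chainOp p q ^ b) h y := by
  induction b generalizing y with
  | zero => simp [ringChain]
  | succ b ih =>
    rw [sum_word_succ, pow_succ', Module.End.mul_apply, chainOp_apply]
    refine Finset.sum_congr rfl fun o _ => ?_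
    rw [← ih, Finset.mul_sum]
    refine Finset.sum_congr rfl fun w _ => ?_
    rw [Fin.prod_univ_succ, ringChain_extendWord_cons]
    simp only [Fin.cons_zero, Fin.cons_succ]
    ring

/-- The Markov property at step `a`: the state there is frozen as a parameter of `h` while the
remaining steps run. -/
theorem sum_word_eq_chainOp_pow_pow (p : Matrix ι ι ℝ) (q : ℝ) (h : (ι → ℝ) → (ι → ℝ) → ℝ)
    (a b : ℕ) (hab : a ≤ b) (y : ι → ℝ) :
    ∑ w : Fin b → Option ι, (∏ j, ringWeight q (w j)) *
        h (ringChain p (extendWord w) y a) (ringChain p (extendWord w) y b) =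
      (chainOp p q ^ a) (fun z => (chainOp p q ^ (b - a)) (h z) z) y := by
  induction a generalizing b y with
  | zero => exact sum_word_eq_chainOp_pow p q (h y) b y
  | succ a ih =>
    obtain ⟨b, rfl⟩ : ∃ c, b = c + 1 := ⟨b - 1, by omega⟩
    rw [sum_word_succ, pow_succ' _ a, Module.End.mul_apply, chainOp_apply, Nat.add_sub_add_right]
    refine Finset.sum_congr rfl fun o _ => ?_
    rw [← ih b (by omega), Finset.mul_sum]
    refine Finset.sum_congr rfl fun w _ => ?_
    rw [Fin.prod_univ_succ, ringChain_extendWord_cons, ringChain_extendWord_cons]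
    simp only [Fin.cons_zero, Fin.cons_succ]
    ring

/-- The sum of the squares of the jumps `((p - 1) y) k`. -/
noncomputable def dissipation (p : Matrix ι ι ℝ) (y : ι → ℝ) : ℝ :=
  ∑ k, ((∑ j, p k j * y j) - y k) ^ 2

theorem dissipation_nonneg (p : Matrix ι ι ℝ) (y : ι → ℝ) : 0 ≤ dissipation p y :=
  Finset.sum_nonneg fun _ _ => sq_nonneg _

theorem siteUpdate_eq_add (p : Matrix ι ι ℝ) (k : ι) (y : ι → ℝ) :
    siteUpdate p k y = y + Pi.single k ((∑ j, p k j * y j) - y k) := by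
  funext i
  by_cases hi : i = k
  · subst hi
    simp [siteUpdate]
  · simp [siteUpdate, hi]

/-- Unit row sums make the updates commute with subtracting a constant, and jumps see only
differences. This later permits centring the initial configuration at any point. -/
theorem chainOp_pow_dissipation_sub_const {p : Matrix ι ι ℝ} (hp : ∀ i, ∑ j, p i j = 1)
    (q c : ℝ) (j : ℕ) (y : ι → ℝ) :
    (chainOp p q ^ j) (dissipation p) (fun i => y i - c) = (chainOp p q ^ j) (dissipation p) y := by
  have hrow : ∀ (y : ι → ℝ) k, ∑ j, p k j * (y j - c) = (∑ j, p k j * y j) - c := by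
    intro y k
    simp only [mul_sub, Finset.sum_sub_distrib, ← Finset.sum_mul, hp, one_mul]
  have hup : ∀ (y : ι → ℝ) (o : Option ι), ringUpdate p o (fun i => y i - c) =
      fun i => ringUpdate p o y i - c := by
    intro y o
    cases o with
    | none => rfl
    | some k =>
      funext i
      by_cases hi : i = k
      · subst hi
        simp [ringUpdate, siteUpdate, hrow]
      · simp [ringUpdate, siteUpdate, hi]
  induction j generalizing y with
  | zero => simp [dissipation, hrow]
  | succ j ih =>
    rw [pow_succ', Module.End.mul_apply, chainOp_apply, chainOp_apply]
    simp only [hup, ih]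

/-- Unit column sums make the jumps over all sites sum to zero, so the cross terms cancel and only
their squares remain. -/
theorem chainOp_sq_sum {p : Matrix ι ι ℝ} (hp : ∀ j, ∑ i, p i j = 1) (q c : ℝ) :
    chainOp p q (fun y => ((∑ i, y i) - c) ^ 2) =
      (fun y => ((∑ i, y i) - c) ^ 2) + q • dissipation p := by
  funext y
  rw [chainOp_apply']
  simp only [siteUpdate_eq_add, Pi.add_apply, Finset.sum_add_distrib, Finset.sum_pi_single',
    Finset.mem_univ, if_true, Pi.smul_apply, smul_eq_mul]
  congr 2
  set v : ι → ℝ := fun k => (∑ j, p k j * y j) - y k with hv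
  have h0 : ∑ k, v k = 0 := by
    simp only [hv, Finset.sum_sub_distrib]
    rw [Finset.sum_comm]
    simp only [← Finset.sum_mul, hp, one_mul, sub_self]
  calc ∑ k, ((∑ i, y i + v k - c) ^ 2 - (∑ i, y i - c) ^ 2)
      = ∑ k, (2 * (∑ i, y i - c) * v k + v k ^ 2) := Finset.sum_congr rfl fun k _ => by ring
    _ = dissipation p y := by
        rw [Finset.sum_add_distrib, ← Finset.mul_sum, h0, mul_zero, zero_add]
        rfl

theorem chainOp_pow_sq_sum {p : Matrix ι ι ℝ} (hp : ∀ j, ∑ i, p i j = 1) (q c : ℝ) (m : ℕ) :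
    (chainOp p q ^ m) (fun y => ((∑ i, y i) - c) ^ 2) =
      (fun y => ((∑ i, y i) - c) ^ 2) +
        q • ∑ j ∈ Finset.range m, (chainOp p q ^ j) (dissipation p) := by
  induction m with
  | zero => simp
  | succ m ih =>
    rw [pow_succ, Module.End.mul_apply, chainOp_sq_sum hp, map_add, ih, map_smul,
      Finset.sum_range_succ, smul_add, add_assoc]

theorem chainOp_pow_increment_sq {p : Matrix ι ι ℝ} (hp : ∀ j, ∑ i, p i j = 1) (q : ℝ)
    (a m : ℕ) (y : ι → ℝ) :
    (chainOp p q ^ a) (fun z => (chainOp p q ^ m) (fun y => ((∑ i, y i) - ∑ i, z i) ^ 2) z) y =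
      q * ∑ j ∈ Finset.range m, (chainOp p q ^ (a + j)) (dissipation p) y := by
  have h : (fun z => (chainOp p q ^ m) (fun y => ((∑ i, y i) - ∑ i, z i) ^ 2) z) =
      q • ∑ j ∈ Finset.range m, (chainOp p q ^ j) (dissipation p) := by
    funext z
    rw [chainOp_pow_sq_sum hp]
    simp
  rw [h, map_smul, map_sum]
  simp only [← Module.End.mul_apply, ← pow_add, Pi.smul_apply, smul_eq_mul, Finset.sum_apply]

end ChainOperator

/-! ### Fourier analysis of the walk and of the second moments. -/

section TorusFourier

variable {d n : ℕ}

/-- For n ≥ 3 the 2d vectors ±e_l are distinct and nonzero, so each neighbour is counted exactly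
once. -/
theorem torusWalk_eq_sum (hn : 3 ≤ n) (i j : Torus d n) :
    torusWalk d n i j = 1 / (2 * (d : ℝ)) *
      ∑ l : Fin d, ((if j = i + Pi.single l 1 then 1 else 0) +
        (if j = i - Pi.single l 1 then 1 else 0)) := by
  classical
  have h1 : (1 : ZMod n) ≠ 0 := by
    have : Fact (1 < n) := ⟨by omega⟩
    exact one_ne_zero
  have h2 : (1 : ZMod n) + 1 ≠ 0 := by
    intro h
    have h3 : ((2 : ℕ) : ZMod n) = 0 := by
      rw [← h]
      norm_num
    rw [ZMod.natCast_eq_zero_iff] at h3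
    have := Nat.le_of_dvd (by norm_num) h3
    omega
  have hinj : ∀ l m : Fin d, (Pi.single l 1 : Torus d n) = Pi.single m 1 → l = m := by
    intro l m h
    by_contra hne
    have := congrFun h l
    simp [hne, h1] at this
  have hneg : ∀ l m : Fin d, (Pi.single l 1 : Torus d n) ≠ -Pi.single m 1 := by
    intro l m h
    by_cases hlm : l = m
    · subst hlm
      have := congrFun h l
      simp only [Pi.single_eq_same, Pi.neg_apply] at this
      exact h2 (by nth_rewrite 1 [this]; ring)
    · have := congrFun h l
      simp [hlm, h1] at this
  have hz : ∀ l : Fin d, (Pi.single l 1 : Torus d n) ≠ 0 := by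
    intro l h
    have := congrFun h l
    simp [h1] at this
  by_cases hadj : (torusGraph d n).Adj i j
  · rw [torusWalk, if_pos hadj]
    have hadj' := hadj
    rw [torusGraph, SimpleGraph.circulantGraph, SimpleGraph.fromRel_adj] at hadj'
    obtain ⟨-, ⟨m, hm⟩ | ⟨m, hm⟩⟩ := hadj'
    · have hj : j = i - Pi.single m 1 := by
        dsimp only at hm
        rw [hm]
        abel
      have : ∀ l : Fin d, ((if j = i + Pi.single l 1 then (1 : ℝ) else 0) +
          (if j = i - Pi.single l 1 then 1 else 0)) = if l = m then 1 else 0 := by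
        intro l
        have e1 : j ≠ i + Pi.single l 1 := by
          rw [hj]
          intro h
          rw [sub_eq_add_neg] at h
          exact hneg l m (add_left_cancel h).symm
        have e2 : j = i - Pi.single l 1 ↔ l = m := by
          rw [hj]
          refine ⟨fun h => (hinj _ _ (sub_right_injective h)).symm, fun h => by rw [h]⟩
        simp only [e1, e2, if_false, zero_add]
      simp [this]
    · have hj : j = i + Pi.single m 1 := by
        dsimp only at hm
        rw [hm]
        abel
      have : ∀ l : Fin d, ((if j = i + Pi.single l 1 then (1 : ℝ) else 0) +
          (if j = i - Pi.single l 1 then 1 else 0)) = if l = m then 1 else 0 := by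
        intro l
        have e1 : j ≠ i - Pi.single l 1 := by
          rw [hj]
          intro h
          rw [sub_eq_add_neg] at h
          exact hneg m l (add_left_cancel h)
        have e2 : j = i + Pi.single l 1 ↔ l = m := by
          rw [hj]
          refine ⟨fun h => (hinj _ _ (add_left_cancel h)).symm, fun h => by rw [h]⟩
        simp only [e1, e2, if_false, add_zero]
      simp [this]
  · rw [torusWalk, if_neg hadj]
    have hno : ∀ l : Fin d, ((if j = i + Pi.single l 1 then (1 : ℝ) else 0) +
        (if j = i - Pi.single l 1 then 1 else 0)) = 0 := by
      intro l
      have e1 : j ≠ i + Pi.single l 1 := by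
        intro h
        refine hadj ?_
        rw [torusGraph, SimpleGraph.circulantGraph, SimpleGraph.fromRel_adj]
        refine ⟨fun h' => hz l ?_, Or.inr ⟨l, ?_⟩⟩
        · rw [h'] at h
          exact left_eq_add.1 h
        · rw [h]
          simp
      have e2 : j ≠ i - Pi.single l 1 := by
        intro h
        refine hadj ?_
        rw [torusGraph, SimpleGraph.circulantGraph, SimpleGraph.fromRel_adj]
        refine ⟨fun h' => hz l ?_, Or.inl ⟨l, ?_⟩⟩
        · rw [h'] at h
          exact sub_eq_self.1 h.symm
        · rw [h]
          simp
      simp [e1, e2]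
    simp [hno]

theorem torusWalk_nonneg (i j : Torus d n) : 0 ≤ torusWalk d n i j := by
  rw [torusWalk]
  split_ifs <;> positivity

theorem torusWalk_symm (i j : Torus d n) : torusWalk d n i j = torusWalk d n j i := by
  classical
  rw [torusWalk, torusWalk]
  exact if_congr ((torusGraph d n).adj_comm i j) rfl rfl

variable [NeZero n]

theorem sum_torusWalk_mul (hn : 3 ≤ n) (i : Torus d n) (y : Torus d n → ℝ) :
    ∑ j, torusWalk d n i j * y j =
      1 / (2 * (d : ℝ)) * ∑ l : Fin d, (y (i + Pi.single l 1) + y (i - Pi.single l 1)) := by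
  classical
  simp only [torusWalk_eq_sum hn, mul_assoc, ← Finset.mul_sum, Finset.sum_mul]
  rw [Finset.sum_comm]
  simp [add_mul, Finset.sum_add_distrib]

theorem sum_torusWalk (hd : 1 ≤ d) (hn : 3 ≤ n) (i : Torus d n) :
    ∑ j, torusWalk d n i j = 1 := by
  have hd' : (d : ℝ) ≠ 0 := by positivity
  have h := sum_torusWalk_mul hn i fun _ => 1
  simp only [mul_one] at h
  rw [h]
  simp only [Finset.sum_const, Finset.card_univ, Fintype.card_fin, nsmul_eq_mul]
  field_simp
  norm_num

theorem card_torus : Fintype.card (Torus d n) = n ^ d := by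
  simp [Torus, ZMod.card]

/-- The additive characters of the torus. -/
noncomputable def torusChar (k : Torus d n) (i : Torus d n) : ℂ :=
  ZMod.stdAddChar (∑ l, k l * i l)

theorem torusChar_add (k i j : Torus d n) :
    torusChar k (i + j) = torusChar k i * torusChar k j := by
  simp only [torusChar, Pi.add_apply, mul_add, Finset.sum_add_distrib, AddChar.map_add_eq_mul]

theorem norm_torusChar (k i : Torus d n) : ‖torusChar k i‖ = 1 := by
  rw [torusChar, ZMod.stdAddChar_apply]
  exact Circle.norm_coe _

theorem conj_torusChar (k i : Torus d n) :
    (starRingEnd ℂ) (torusChar k i) = torusChar k (-i) := by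
  simp only [torusChar, Pi.neg_apply, mul_neg, Finset.sum_neg_distrib, AddChar.map_neg_eq_conj]

theorem torusChar_single (k : Torus d n) (l : Fin d) :
    torusChar k (Pi.single l 1) = ZMod.stdAddChar (k l) := by
  classical
  rw [torusChar]
  congr 1
  rw [Finset.sum_eq_single l] <;> simp +contextual

theorem sum_torusChar (x : Torus d n) :
    ∑ k, torusChar k x = if x = 0 then (n : ℂ) ^ d else 0 := by
  classical
  have h : ∀ k : Torus d n, torusChar k x = ∏ l, ZMod.stdAddChar (k l * x l) := by
    intro k
    have := map_prod ZMod.stdAddChar.toMonoidHom (fun l => Multiplicative.ofAdd (k l * x l)) Finset.univ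
    rw [← ofAdd_sum] at this
    exact this
  simp only [h]
  rw [← Fintype.prod_sum fun (l : Fin d) (a : ZMod n) => ZMod.stdAddChar (a * x l)]
  simp only [AddChar.sum_mulShift _ (ZMod.isPrimitive_stdAddChar n), ZMod.card]
  split_ifs with hx
  · subst hx
    simp
  · obtain ⟨l, hl⟩ := Function.ne_iff.1 hx
    refine Finset.prod_eq_zero (Finset.mem_univ l) ?_
    rw [if_neg (show x l ≠ 0 from hl), Nat.cast_zero]

/-- The Fourier coefficient of `y` at `k`. -/
noncomputable def torusFourier (y : Torus d n → ℝ) (k : Torus d n) : ℂ :=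
  ∑ i, (y i : ℂ) * torusChar k i

/-- The eigenvalues of the Laplacian `1 - P` of the torus. -/
noncomputable def torusEigen (k : Torus d n) : ℝ :=
  1 / (d : ℝ) * ∑ l, (1 - Real.cos (2 * Real.pi * (k l).val / n))

/-- The source of the ℓ¹ norm on the right side of the theorem. -/
theorem normSq_torusFourier_le (y : Torus d n → ℝ) (k : Torus d n) :
    Complex.normSq (torusFourier y k) ≤ (∑ i, |y i|) ^ 2 := by
  rw [Complex.normSq_eq_norm_sq]
  refine pow_le_pow_left₀ (norm_nonneg _) ((norm_sum_le _ _).trans (le_of_eq ?_)) 2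
  refine Finset.sum_congr rfl fun i _ => ?_
  rw [norm_mul, norm_torusChar, mul_one, Complex.norm_real, Real.norm_eq_abs]

theorem sum_normSq_torusFourier (y : Torus d n → ℝ) :
    ∑ k, Complex.normSq (torusFourier y k) = (n : ℝ) ^ d * ∑ i, y i ^ 2 := by
  classical
  have h : ∀ k, ((Complex.normSq (torusFourier y k) : ℝ) : ℂ) =
      ∑ i, ∑ j, (y i : ℂ) * y j * torusChar k (i - j) := by
    intro k
    rw [← Complex.mul_conj, torusFourier, map_sum, Finset.sum_mul_sum]
    refine Finset.sum_congr rfl fun i _ => Finset.sum_congr rfl fun j _ => ?_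
    rw [map_mul, Complex.conj_ofReal, conj_torusChar, sub_eq_add_neg, torusChar_add]
    ring
  have h2 : ((∑ k, Complex.normSq (torusFourier y k) : ℝ) : ℂ) =
      (((n : ℝ) ^ d * ∑ i, y i ^ 2 : ℝ) : ℂ) := by
    push_cast
    simp only [h]
    rw [Finset.sum_comm, Finset.mul_sum]
    refine Finset.sum_congr rfl fun i _ => ?_
    rw [Finset.sum_comm]
    simp only [← Finset.mul_sum, sum_torusChar, sub_eq_zero]
    simp
    ring
  exact_mod_cast h2

theorem stdAddChar_add_neg (a : ZMod n) :
    (ZMod.stdAddChar a : ℂ) + ZMod.stdAddChar (-a) =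
      ((2 * Real.cos (2 * Real.pi * a.val / n) : ℝ) : ℂ) := by
  have h : (ZMod.stdAddChar a : ℂ) =
      Complex.exp (((2 * Real.pi * a.val / n : ℝ) : ℂ) * Complex.I) := by
    rw [ZMod.stdAddChar_apply, ZMod.toCircle_apply]
    congr 1
    push_cast
    ring
  rw [AddChar.map_neg_eq_conj, Complex.add_conj, h, Complex.exp_ofReal_mul_I_re]

theorem torusFourier_jump (hd : 1 ≤ d) (hn : 3 ≤ n) (y : Torus d n → ℝ) (k : Torus d n) :
    torusFourier (fun i => (∑ j, torusWalk d n i j * y j) - y i) k =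
      -(torusEigen k : ℂ) * torusFourier y k := by
  have hshift : ∀ x : Torus d n, ∑ i, (y (i + x) : ℂ) * torusChar k i =
      torusChar k (-x) * torusFourier y k := by
    intro x
    rw [torusFourier, Finset.mul_sum]
    refine Fintype.sum_equiv (Equiv.addRight x) _ _ fun i => ?_
    simp only [Equiv.coe_addRight]
    rw [mul_left_comm, ← torusChar_add]
    congr 2
    abel
  have hchar : ∀ l : Fin d, torusChar k (-Pi.single l 1) + torusChar k (Pi.single l 1) =
      ((2 * Real.cos (2 * Real.pi * (k l).val / n) : ℝ) : ℂ) := by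
    intro l
    rw [← stdAddChar_add_neg, ← conj_torusChar, torusChar_single, ← AddChar.map_neg_eq_conj]
    ring
  have hd' : (d : ℂ) ≠ 0 := by
    have : d ≠ 0 := by omega
    exact_mod_cast this
  have h1 : torusFourier (fun i => (∑ j, torusWalk d n i j * y j) - y i) k =
      (1 / (2 * (d : ℂ)) * ∑ l : Fin d, (torusChar k (-Pi.single l 1) +
        torusChar k (Pi.single l 1))) * torusFourier y k - torusFourier y k := by
    rw [torusFourier]
    simp only [sum_torusWalk_mul hn, Complex.ofReal_sub, sub_mul, Finset.sum_sub_distrib]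
    congr 1
    push_cast
    simp only [mul_assoc, ← Finset.mul_sum, Finset.sum_mul]
    rw [Finset.sum_comm]
    congr 1
    refine Finset.sum_congr rfl fun l _ => ?_
    simp only [add_mul, Finset.sum_add_distrib, sub_eq_add_neg, hshift, neg_neg]
  rw [h1]
  simp only [hchar, torusEigen]
  push_cast
  rw [← Finset.mul_sum, Finset.sum_sub_distrib]
  simp only [Finset.sum_const, Finset.card_univ, Fintype.card_fin, nsmul_eq_mul]
  field_simp
  ring

theorem dissipation_eq_sum (hd : 1 ≤ d) (hn : 3 ≤ n) (y : Torus d n → ℝ) :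
    dissipation (torusWalk d n) y =
      ((n : ℝ) ^ d)⁻¹ * ∑ k, torusEigen k ^ 2 * Complex.normSq (torusFourier y k) := by
  have hD : (n : ℝ) ^ d ≠ 0 := pow_ne_zero _ (NeZero.ne _)
  have h := sum_normSq_torusFourier fun i => (∑ j, torusWalk d n i j * y j) - y i
  rw [dissipation, eq_inv_mul_iff_mul_eq₀ hD, ← h]
  refine Finset.sum_congr rfl fun k _ => ?_
  rw [torusFourier_jump hd hn, map_mul, Complex.normSq_neg, Complex.normSq_ofReal]
  ring

/-- A ring at κ adds v_κ χ_k(κ) to the coefficient. The cross terms sum to -2λ_k|ŷ_k|², and as |χ_k|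
= 1 the squares sum to the dissipation for every k, so the second moments form a closed system. -/
theorem chainOp_normSq_torusFourier (hd : 1 ≤ d) (hn : 3 ≤ n) (q : ℝ) (k : Torus d n) :
    chainOp (torusWalk d n) q (fun y => Complex.normSq (torusFourier y k)) =
      (1 - 2 * q * torusEigen k) • (fun y => Complex.normSq (torusFourier y k)) +
        q • dissipation (torusWalk d n) := by
  classical
  funext y
  set v : Torus d n → ℝ := fun i => (∑ j, torusWalk d n i j * y j) - y i with hv
  have hup : ∀ κ, torusFourier (siteUpdate (torusWalk d n) κ y) k =
      torusFourier y k + (v κ : ℂ) * torusChar k κ := by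
    intro κ
    rw [siteUpdate_eq_add, torusFourier, torusFourier]
    simp only [Pi.add_apply, Complex.ofReal_add, add_mul, Finset.sum_add_distrib]
    congr 1
    rw [Finset.sum_eq_single κ]
    · simp [hv]
    · intro i _ hi
      simp [hi]
    · simp
  rw [chainOp_apply']
  simp only [hup, Complex.normSq_add, Pi.add_apply, Pi.smul_apply, smul_eq_mul]
  have hterm : ∀ κ, Complex.normSq (torusFourier y k) + Complex.normSq ((v κ : ℂ) * torusChar k κ) +
      2 * (torusFourier y k * (starRingEnd ℂ) ((v κ : ℂ) * torusChar k κ)).re -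
      Complex.normSq (torusFourier y k) = v κ ^ 2 +
      2 * (torusFourier y k * (starRingEnd ℂ) ((v κ : ℂ) * torusChar k κ)).re := by
    intro κ
    rw [map_mul, Complex.normSq_ofReal, Complex.normSq_eq_norm_sq (torusChar k κ), norm_torusChar]
    ring
  simp only [hterm]
  rw [Finset.sum_add_distrib, ← Finset.mul_sum, ← Complex.re_sum, ← Finset.mul_sum, ← map_sum]
  have hF : ∑ κ, (v κ : ℂ) * torusChar k κ = -(torusEigen k : ℂ) * torusFourier y k :=
    torusFourier_jump hd hn y k
  rw [hF, map_mul, map_neg, Complex.conj_ofReal, mul_left_comm, Complex.mul_conj]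
  rw [← Complex.ofReal_neg, ← Complex.ofReal_mul, Complex.ofReal_re]
  have hdis : dissipation (torusWalk d n) y = ∑ κ, v κ ^ 2 := rfl
  rw [hdis]
  ring

end TorusFourier

/-! ### Estimates on the spectrum of the torus. -/

section TorusSpectrum

variable {d n : ℕ} [NeZero n]

/-- The distance of `m` to zero on the cycle. -/
def cycleDist (m : ZMod n) : ℕ := min m.val (n - m.val)

theorem two_mul_cycleDist_le (m : ZMod n) : 2 * cycleDist m ≤ n := by
  have := m.val_lt
  simp only [cycleDist]
  omega

theorem cos_val_eq_cos_cycleDist (m : ZMod n) :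
    Real.cos (2 * Real.pi * m.val / n) = Real.cos (2 * Real.pi * cycleDist m / n) := by
  have hn : (n : ℝ) ≠ 0 := NeZero.ne _
  have hlt := m.val_lt
  rcases min_choice m.val (n - m.val) with h | h
  · rw [cycleDist, h]
  · rw [cycleDist, h, Nat.cast_sub hlt.le, ← Real.cos_two_pi_sub]
    congr 1
    field_simp

theorem angle_cycleDist_le (m : ZMod n) : 2 * Real.pi * cycleDist m / n ≤ Real.pi := by
  have hn : (0 : ℝ) < n := Nat.cast_pos.2 (NeZero.pos n)
  have h : (2 : ℝ) * cycleDist m ≤ n := by exact_mod_cast two_mul_cycleDist_le m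
  rw [div_le_iff₀ hn]
  nlinarith [Real.pi_pos]

theorem le_one_sub_cos_val (m : ZMod n) :
    8 * (cycleDist m : ℝ) ^ 2 / (n : ℝ) ^ 2 ≤ 1 - Real.cos (2 * Real.pi * m.val / n) := by
  have hn : (n : ℝ) ≠ 0 := NeZero.ne _
  have hpi := Real.pi_pos.ne'
  rw [cos_val_eq_cos_cycleDist]
  have h0 : 0 ≤ 2 * Real.pi * cycleDist m / n := by positivity
  have h := Real.cos_le_one_sub_mul_cos_sq
    (x := 2 * Real.pi * cycleDist m / n) (by rw [abs_of_nonneg h0]; exact angle_cycleDist_le m)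
  have h2 : 2 / Real.pi ^ 2 * (2 * Real.pi * cycleDist m / n) ^ 2 =
      8 * (cycleDist m : ℝ) ^ 2 / (n : ℝ) ^ 2 := by
    field_simp
    ring
  linarith

theorem cycleGap_le_one_sub_cos_val {m : ZMod n} (hm : m ≠ 0) :
    cycleGap n ≤ 1 - Real.cos (2 * Real.pi * m.val / n) := by
  have hn : (0 : ℝ) < n := Nat.cast_pos.2 (NeZero.pos n)
  have h1 : 1 ≤ cycleDist m := by
    have := m.val_lt
    have : m.val ≠ 0 := by simpa using hm
    simp only [cycleDist]
    omega
  rw [cos_val_eq_cos_cycleDist, cycleGap]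
  have : Real.cos (2 * Real.pi * cycleDist m / n) ≤ Real.cos (2 * Real.pi / n) := by
    refine Real.cos_le_cos_of_nonneg_of_le_pi (by positivity) (angle_cycleDist_le m) ?_
    have h2 : (1 : ℝ) ≤ cycleDist m := by exact_mod_cast h1
    exact div_le_div_of_nonneg_right (le_mul_of_one_le_right (by positivity) h2) hn.le
  linarith

theorem cycleGap_le (n : ℕ) [NeZero n] : cycleGap n ≤ 20 / (n : ℝ) ^ 2 := by
  have hn : (0 : ℝ) < n := Nat.cast_pos.2 (NeZero.pos n)
  have h := Real.one_sub_sq_div_two_le_cos (x := 2 * Real.pi / n)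
  have hpi : Real.pi ^ 2 ≤ 10 := by nlinarith [Real.pi_lt_d2, Real.pi_pos]
  have h2 : (2 * Real.pi / n) ^ 2 / 2 = 2 * Real.pi ^ 2 / (n : ℝ) ^ 2 := by
    field_simp
  have h3 : 2 * Real.pi ^ 2 / (n : ℝ) ^ 2 ≤ 20 / (n : ℝ) ^ 2 := by
    gcongr
    linarith
  rw [cycleGap]
  linarith

theorem le_cycleGap (hn : 2 ≤ n) : 8 / (n : ℝ) ^ 2 ≤ cycleGap n := by
  have : Fact (1 < n) := ⟨hn⟩
  have h := le_one_sub_cos_val (1 : ZMod n)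
  have h1 : (1 : ZMod n).val = 1 := ZMod.val_one n
  have h2 : cycleDist (1 : ZMod n) = 1 := by
    simp only [cycleDist, h1]
    omega
  rw [h2, h1] at h
  simpa [cycleGap] using h

theorem torusEigen_nonneg (k : Torus d n) : 0 ≤ torusEigen k := by
  unfold torusEigen
  refine mul_nonneg (by positivity) (Finset.sum_nonneg fun l _ => ?_)
  linarith [Real.cos_le_one (2 * Real.pi * (k l).val / n)]

theorem torusEigen_le_two (hd : 1 ≤ d) (k : Torus d n) : torusEigen k ≤ 2 := by
  have hd' : (0 : ℝ) < d := by positivity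
  rw [torusEigen, one_div, inv_mul_le_iff₀ hd']
  calc ∑ l : Fin d, (1 - Real.cos (2 * Real.pi * (k l).val / n)) ≤ ∑ l : Fin d, (2 : ℝ) :=
        Finset.sum_le_sum fun l _ => by
          linarith [Real.neg_one_le_cos (2 * Real.pi * (k l).val / n)]
    _ = d * 2 := by simp

theorem torusEigen_zero : torusEigen (0 : Torus d n) = 0 := by
  simp [torusEigen]

theorem one_sub_cos_le_torusEigen (hd : 1 ≤ d) (k : Torus d n) (l : Fin d) :
    (1 - Real.cos (2 * Real.pi * (k l).val / n)) / d ≤ torusEigen k := by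
  have hd' : (0 : ℝ) < d := by positivity
  rw [torusEigen, div_eq_inv_mul, one_div]
  gcongr
  refine Finset.single_le_sum (f := fun l => 1 - Real.cos (2 * Real.pi * (k l).val / n))
    (fun l _ => ?_) (Finset.mem_univ l)
  linarith [Real.cos_le_one (2 * Real.pi * (k l).val / n)]

theorem gap_le_torusEigen (hd : 1 ≤ d) {k : Torus d n} (hk : k ≠ 0) :
    cycleGap n / d ≤ torusEigen k := by
  have hd' : (0 : ℝ) < d := by positivity
  obtain ⟨l, hl⟩ := Function.ne_iff.1 hk
  refine le_trans ?_ (one_sub_cos_le_torusEigen hd k l)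
  gcongr
  exact cycleGap_le_one_sub_cos_val hl

/-- The trace of 1 - P: each cosine sum vanishes as a sum of all characters at the nonzero points
±e_l. -/
theorem sum_torusEigen (hd : 1 ≤ d) (hn : 2 ≤ n) :
    ∑ k : Torus d n, torusEigen k = (n : ℝ) ^ d := by
  have : Fact (1 < n) := ⟨hn⟩
  have hd' : (d : ℝ) ≠ 0 := by positivity
  have h0 : ∀ l : Fin d, ∑ k : Torus d n, Real.cos (2 * Real.pi * (k l).val / n) = 0 := by
    intro l
    have h1 : ∀ x : Torus d n, x = Pi.single l 1 ∨ x = Pi.single l (-1) →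
        ∑ k, torusChar k x = 0 := by
      intro x hx
      rw [sum_torusChar, if_neg]
      intro h
      rcases hx with hx | hx
      · have := congrFun (hx.symm.trans h) l
        simp at this
      · have := congrFun (hx.symm.trans h) l
        simp at this
    have h2 : ∀ k : Torus d n, ((2 * Real.cos (2 * Real.pi * (k l).val / n) : ℝ) : ℂ) =
        torusChar k (Pi.single l 1) + torusChar k (Pi.single l (-1)) := by
      intro k
      rw [← stdAddChar_add_neg, Pi.single_neg, ← conj_torusChar, torusChar_single,
        AddChar.map_neg_eq_conj]
    have h3 : ((∑ k : Torus d n, 2 * Real.cos (2 * Real.pi * (k l).val / n) : ℝ) : ℂ) = 0 := by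
      rw [Complex.ofReal_sum, Finset.sum_congr rfl fun k _ => h2 k, Finset.sum_add_distrib,
        h1 _ (Or.inl rfl), h1 _ (Or.inr rfl), add_zero]
    have h4 := Complex.ofReal_eq_zero.1 h3
    rw [← Finset.mul_sum] at h4
    linarith
  simp only [torusEigen]
  rw [← Finset.mul_sum, Finset.sum_comm]
  simp only [Finset.sum_sub_distrib, h0, sub_zero, Finset.sum_const, Finset.card_univ,
    card_torus, Fintype.card_fin, nsmul_eq_mul, mul_one, Nat.cast_pow]
  field_simp

/-- Every coordinate of such a k satisfies 8 · dist² < 2 · 20, so dist ≤ 2 and it takes at most five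
values. -/
theorem card_torusEigen_lt (hd : 1 ≤ d) :
    ((Finset.univ.filter fun k : Torus d n => torusEigen k < 2 * (cycleGap n / d)).card : ℝ) ≤
      5 ^ d := by
  classical
  have hn : (0 : ℝ) < n := Nat.cast_pos.2 (NeZero.pos n)
  have hd' : (0 : ℝ) < d := by positivity
  set S : Finset (ZMod n) := {0, 1, 2, -1, -2} with hS
  have hScard : S.card ≤ 5 := Finset.card_le_five
  have hsub : (Finset.univ.filter fun k : Torus d n => torusEigen k < 2 * (cycleGap n / d)) ⊆
      Fintype.piFinset fun _ : Fin d => S := by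
    intro k hk
    rw [Finset.mem_filter] at hk
    rw [Fintype.mem_piFinset]
    intro l
    have h1 := (one_sub_cos_le_torusEigen hd k l).trans_lt hk.2
    rw [← mul_div_assoc, div_lt_div_iff_of_pos_right hd'] at h1
    have h2 := (le_one_sub_cos_val (k l)).trans_lt (h1.trans_le
      (mul_le_mul_of_nonneg_left (cycleGap_le n) zero_le_two))
    rw [← mul_div_assoc, div_lt_div_iff_of_pos_right (by positivity)] at h2
    have h3 : cycleDist (k l) ≤ 2 := by
      by_contra hcon
      have : (3 : ℝ) ≤ cycleDist (k l) := by exact_mod_cast not_le.1 hcon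
      nlinarith
    have hlt := (k l).val_lt
    have hval : (((k l).val : ℕ) : ZMod n) = k l := ZMod.natCast_zmod_val _
    have hneg : ∀ a : ℕ, (k l).val + a = n → k l = -(a : ZMod n) := by
      intro a ha
      rw [eq_neg_iff_add_eq_zero]
      nth_rewrite 1 [← hval]
      rw [← Nat.cast_add, ha, ZMod.natCast_self]
    simp only [hS, Finset.mem_insert, Finset.mem_singleton]
    simp only [cycleDist] at h3
    have hcases : (k l).val = 0 ∨ (k l).val = 1 ∨ (k l).val = 2 ∨ (k l).val + 1 = n ∨
        (k l).val + 2 = n := by omega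
    rcases hcases with h | h | h | h | h
    · left
      rw [← hval, h, Nat.cast_zero]
    · right; left
      rw [← hval, h, Nat.cast_one]
    · right; right; left
      rw [← hval, h, Nat.cast_ofNat]
    · right; right; right; left
      simpa using hneg 1 h
    · right; right; right; right
      simpa using hneg 2 h
  have h := Finset.card_le_card hsub
  rw [Fintype.card_piFinset, Finset.prod_const, Finset.card_univ, Fintype.card_fin] at h
  exact_mod_cast h.trans (Nat.pow_le_pow_left hScard d)

theorem sum_exp_neg_mul_le {c : ℝ} (hc : 0 < c) (m : ℕ) :
    ∑ j ∈ Finset.range m, Real.exp (-(c * j)) ≤ 1 + 1 / c := by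
  have h1 : ∀ j : ℕ, Real.exp (-(c * j)) = Real.exp (-c) ^ j := by
    intro j
    rw [← Real.exp_nat_mul]
    ring_nf
  have hlt : Real.exp (-c) < 1 := Real.exp_lt_one_iff.2 (by linarith)
  simp only [h1]
  have h2 := geom_sum_mul_neg (Real.exp (-c)) m
  have h3 : 0 < Real.exp (-c) ^ m := by positivity
  have h4 : ∑ j ∈ Finset.range m, Real.exp (-c) ^ j ≤ 1 / (1 - Real.exp (-c)) := by
    rw [le_div_iff₀ (by linarith)]
    linarith
  refine h4.trans ?_
  have h5 := Real.add_one_le_exp c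
  have h6 : Real.exp (-c) ≤ 1 / (c + 1) := by
    rw [Real.exp_neg, ← one_div]
    exact one_div_le_one_div_of_le (by linarith) h5
  have h7 : c / (c + 1) ≤ 1 - Real.exp (-c) := by
    have : c / (c + 1) = 1 - 1 / (c + 1) := by
      field_simp
      ring
    linarith
  calc 1 / (1 - Real.exp (-c)) ≤ 1 / (c / (c + 1)) :=
        one_div_le_one_div_of_le (by positivity) h7
    _ = 1 + 1 / c := by
        field_simp

theorem sum_zmod_val (f : ℕ → ℝ) :
    ∑ m : ZMod n, f m.val = ∑ j ∈ Finset.range n, f j := by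
  obtain ⟨n, rfl⟩ : ∃ m, n = m + 1 := ⟨n - 1, by have := NeZero.pos n; omega⟩
  exact Fin.sum_univ_eq_sum_range f (n + 1)

/-- The exponents are at least (c · dist)², so the sum is dominated by a Gaussian sum, and in turn
by two geometric series, one for each way around the cycle. -/
theorem sum_exp_cycle_le {a : ℝ} (ha : 0 < a) :
    ∑ m : ZMod n, Real.exp (-(a * (1 - Real.cos (2 * Real.pi * m.val / n)))) ≤
      3 * (1 + n / Real.sqrt (8 * a)) := by
  have hn : (0 : ℝ) < n := Nat.cast_pos.2 (NeZero.pos n)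
  set c : ℝ := Real.sqrt (8 * a) / n with hc
  have hs : 0 < Real.sqrt (8 * a) := Real.sqrt_pos.2 (by linarith)
  have hc0 : 0 < c := by positivity
  have hc2 : c ^ 2 = 8 * a / (n : ℝ) ^ 2 := by
    rw [hc, div_pow, Real.sq_sqrt (by linarith)]
  have hexp : Real.exp (1 / 4) ≤ 3 / 2 := by
    have h := Real.add_one_le_exp (-(1 / 4 : ℝ))
    have h3 : Real.exp (1 / 4) * Real.exp (-(1 / 4)) = 1 := by
      rw [← Real.exp_add]
      norm_num
    nlinarith [Real.exp_pos (1 / 4)]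
  have hterm : ∀ m : ZMod n, Real.exp (-(a * (1 - Real.cos (2 * Real.pi * m.val / n)))) ≤
      3 / 2 * (Real.exp (-(c * m.val)) + Real.exp (-(c * (n - m.val : ℕ)))) := by
    intro m
    have h1 : (c * cycleDist m) ^ 2 ≤ a * (1 - Real.cos (2 * Real.pi * m.val / n)) := by
      rw [mul_pow, hc2]
      have := mul_le_mul_of_nonneg_left (le_one_sub_cos_val m) ha.le
      calc _ = a * (8 * (cycleDist m : ℝ) ^ 2 / (n : ℝ) ^ 2) := by ring
        _ ≤ _ := this
    -- From x² ≥ x - 1/4 with x = c · dist: the Gaussian becomes an exponential at the cost of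
    -- e^{1/4} ≤ 3/2.
    have h2 : -(a * (1 - Real.cos (2 * Real.pi * m.val / n))) ≤
        1 / 4 + -(c * cycleDist m) := by
      nlinarith [sq_nonneg (c * cycleDist m - 1 / 2)]
    refine (Real.exp_le_exp.2 h2).trans ?_
    rw [Real.exp_add]
    refine mul_le_mul hexp ?_ (Real.exp_nonneg _) (by norm_num)
    have e1 := Real.exp_pos (-(c * m.val))
    have e2 := Real.exp_pos (-(c * (n - m.val : ℕ)))
    rcases min_choice m.val (n - m.val) with h | h
    · rw [cycleDist, h]
      linarith
    · rw [cycleDist, h]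
      linarith
  refine (Finset.sum_le_sum fun m _ => hterm m).trans ?_
  rw [← Finset.mul_sum, Finset.sum_add_distrib,
    sum_zmod_val fun j => Real.exp (-(c * j)), sum_zmod_val fun j => Real.exp (-(c * (n - j : ℕ)))]
  have h1 := sum_exp_neg_mul_le hc0 n
  have h2 : ∑ j ∈ Finset.range n, Real.exp (-(c * (n - j : ℕ))) ≤ 1 + 1 / c := by
    rw [← Finset.sum_range_reflect]
    refine le_trans (Finset.sum_le_sum fun j hj => ?_) h1
    rw [Finset.mem_range] at hj
    refine Real.exp_le_exp.2 (neg_le_neg ?_)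
    gcongr
    omega
  have h3 : 1 / c = n / Real.sqrt (8 * a) := by
    rw [hc, one_div_div]
  rw [← h3]
  linarith

theorem sum_exp_torusEigen_le (hd : 1 ≤ d) {v : ℝ} (hv : 0 < v) :
    ((n : ℝ) ^ d)⁻¹ * ∑ k : Torus d n, Real.exp (-(v / 2 * torusEigen k)) ≤
      (3 * d * (1 / n + 1 / Real.sqrt v)) ^ d := by
  have hn : (0 : ℝ) < n := Nat.cast_pos.2 (NeZero.pos n)
  have hd' : (1 : ℝ) ≤ d := by exact_mod_cast hd
  have hprod : ∀ k : Torus d n, Real.exp (-(v / 2 * torusEigen k)) =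
      ∏ l, Real.exp (-(v / (2 * d) * (1 - Real.cos (2 * Real.pi * (k l).val / n)))) := by
    intro k
    rw [← Real.exp_sum, torusEigen, Finset.sum_neg_distrib, ← Finset.mul_sum]
    congr 2
    field_simp
  simp only [hprod]
  rw [← Fintype.prod_sum fun (_ : Fin d) (m : ZMod n) =>
    Real.exp (-(v / (2 * d) * (1 - Real.cos (2 * Real.pi * m.val / n)))),
    Finset.prod_const, Finset.card_univ, Fintype.card_fin, ← inv_pow, ← mul_pow]
  refine pow_le_pow_left₀ (by positivity) ?_ d
  have hpos : 0 < v / (2 * d) := by positivity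
  have h := sum_exp_cycle_le (n := n) hpos
  have hs : Real.sqrt v / d ≤ Real.sqrt (8 * (v / (2 * d))) := by
    refine Real.le_sqrt_of_sq_le ?_
    rw [div_pow, Real.sq_sqrt hv.le, show 8 * (v / (2 * d)) = 4 * v / d by field_simp; norm_num,
      div_le_div_iff₀ (by positivity) (by positivity)]
    nlinarith [mul_pos hv (show (0 : ℝ) < d by positivity)]
  have hsv : 0 < Real.sqrt v := Real.sqrt_pos.2 hv
  have h2 : n / Real.sqrt (8 * (v / (2 * d))) ≤ n * d / Real.sqrt v := by
    calc n / Real.sqrt (8 * (v / (2 * d))) ≤ n / (Real.sqrt v / d) :=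
          div_le_div_of_nonneg_left hn.le (by positivity) hs
      _ = n * d / Real.sqrt v := by field_simp
  rw [inv_mul_le_iff₀ hn]
  calc _ ≤ 3 * (1 + n / Real.sqrt (8 * (v / (2 * d)))) := h
    _ ≤ 3 * (d + n * d / Real.sqrt v) := by gcongr
    _ = n * (3 * d * (1 / n + 1 / Real.sqrt v)) := by field_simp

end TorusSpectrum

/-! ### The tilted renewal kernel: its mass and its decay. -/

section Kernel

/-- The constant in the correction of order `n^{-(d+4)}` to the decay rate. -/
def gapLoss (d : ℕ) : ℝ := 12800 * 5 ^ d

/-- The decay rate of the second moments on the torus. -/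
noncomputable def tilt (d n : ℕ) : ℝ := 2 * (cycleGap n / d) - gapLoss d / (n : ℝ) ^ (d + 4)

/-- The profile `(1 + u)^{-(d+4)/2} + n^{-(d+4)}`. -/
noncomputable def decay (d n : ℕ) (u : ℝ) : ℝ :=
  (1 / Real.sqrt (1 + u)) ^ (d + 4) + (1 / (n : ℝ)) ^ (d + 4)

/-- The renewal kernel of the second moments, tilted by `(1 - qθ)^{-m}`. -/
noncomputable def torusKernel (d n : ℕ) [NeZero n] (q θ : ℝ) (m : ℕ) : ℝ :=
  ((n : ℝ) ^ d)⁻¹ * ∑ k : Torus d n,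
    torusEigen k ^ 2 * ((1 - 2 * q * torusEigen k) / (1 - q * θ)) ^ m

variable {d n : ℕ}

theorem decay_nonneg (u : ℝ) : 0 ≤ decay d n u := by
  unfold decay
  positivity

/-- The sharp factor is c^{-(d+4)/2}; the weaker c^{-(d+4)}, from c ≤ √c, avoids half-integer
powers. -/
theorem decay_le_mul {c u w : ℝ} (hc : 0 < c) (hc1 : c ≤ 1) (hu : 0 ≤ u)
    (h : c * (1 + u) ≤ 1 + w) : decay d n w ≤ (1 / c) ^ (d + 4) * decay d n u := by
  have h1 : 1 / Real.sqrt (1 + w) ≤ 1 / c * (1 / Real.sqrt (1 + u)) := by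
    have hs : 0 < Real.sqrt (1 + u) := Real.sqrt_pos.2 (by linarith)
    rw [one_div_mul_one_div]
    refine one_div_le_one_div_of_le (by positivity) (Real.le_sqrt_of_sq_le ?_)
    rw [mul_pow, Real.sq_sqrt (by linarith)]
    refine le_trans (mul_le_mul_of_nonneg_right ?_ (by linarith)) h
    nlinarith
  rw [decay, decay, mul_add, ← mul_pow]
  refine add_le_add (pow_le_pow_left₀ (by positivity) h1 _) ?_
  refine le_mul_of_one_le_left (by positivity) (one_le_pow₀ ?_)
  rw [le_div_iff₀ hc]
  linarith

variable [NeZero n]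

theorem tilt_le : tilt d n ≤ 2 * (cycleGap n / d) := by
  rw [tilt, gapLoss]
  have : (0 : ℝ) ≤ 12800 * 5 ^ d / (n : ℝ) ^ (d + 4) := by positivity
  linarith

/-- Once n ≥ d · `gapLoss d`, the correction is at most 8/(d n²), hence at most one copy of the gap.
-/
theorem le_tilt (hd : 1 ≤ d) (hn : 12800 * 5 ^ d * d ≤ n) : cycleGap n / d ≤ tilt d n := by
  have hd' : (0 : ℝ) < d := by positivity
  have hn0 : (0 : ℝ) < n := Nat.cast_pos.2 (NeZero.pos n)
  have hn1 : (1 : ℝ) ≤ n := by exact_mod_cast NeZero.pos n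
  have hn' : (12800 * 5 ^ d * d : ℝ) ≤ n := by exact_mod_cast hn
  have h2 : 2 ≤ n := by
    have : 1 ≤ 5 ^ d * d := Nat.mul_pos (by positivity) hd
    nlinarith
  have h1 : gapLoss d / (n : ℝ) ^ (d + 4) ≤ 8 / (n : ℝ) ^ 2 / d := by
    rw [gapLoss, div_div, div_le_div_iff₀ (by positivity) (by positivity)]
    calc 12800 * 5 ^ d * ((n : ℝ) ^ 2 * d) = (12800 * 5 ^ d * d) * (n : ℝ) ^ 2 := by ring
      _ ≤ n * (n : ℝ) ^ 2 := by gcongr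
      _ = 1 * (n : ℝ) ^ 3 := by ring
      _ ≤ 8 * (n : ℝ) ^ (d + 4) := by
        gcongr
        · norm_num
        · omega
  have h3 : 8 / (n : ℝ) ^ 2 / d ≤ cycleGap n / d := by
    gcongr
    exact le_cycleGap h2
  rw [tilt]
  linarith

/-- The prefactor equals (1 - r)/(2λ - θ) for the ratio r, so the geometric series cancels it: the
discrete form of ∫ e^{-(2λ-θ)u} du. -/
theorem sum_geometric_tilt_le {q θ lam : ℝ} (hx : 0 < 1 - q * θ)
    (hlam : 0 ≤ 1 - 2 * q * lam) (h : θ < 2 * lam) (J : ℕ) :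
    ∑ m ∈ Finset.range J, q / (1 - q * θ) * ((1 - 2 * q * lam) / (1 - q * θ)) ^ m ≤
      1 / (2 * lam - θ) := by
  have h0 : 0 < 2 * lam - θ := by linarith
  set r := (1 - 2 * q * lam) / (1 - q * θ) with hr
  have h1 : q / (1 - q * θ) = (1 - r) / (2 * lam - θ) := by
    rw [hr]
    field_simp
    ring
  have h2 := geom_sum_mul_neg r J
  have h3 : 0 ≤ r ^ J := pow_nonneg (div_nonneg hlam hx.le) J
  rw [← Finset.mul_sum, h1, div_mul_eq_mul_div]
  refine div_le_div_of_nonneg_right ?_ h0.le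
  linarith

/-- The mass is at most n^{-d} Σ λ²/(2λ - θ), and 3/4 = 1/2 + 1/8 + 1/8: the trace, the error γ, and
the modes near the gap. -/
theorem sum_torusKernel_le (hd : 1 ≤ d) (hn : 12800 * 5 ^ d * d ≤ n) {q : ℝ} (hq : 0 < q)
    (hq1 : q ≤ 1 / 8) (J : ℕ) :
    ∑ m ∈ Finset.range J, q / (1 - q * tilt d n) * torusKernel d n q (tilt d n) m ≤ 3 / 4 := by
  classical
  have hd' : (1 : ℝ) ≤ d := by exact_mod_cast hd
  have hn0 : (0 : ℝ) < n := Nat.cast_pos.2 (NeZero.pos n)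
  have h2n : 160 ≤ n := by
    have : 1 ≤ 5 ^ d * d := Nat.mul_pos (by positivity) hd
    nlinarith
  have hn160 : (160 : ℝ) ≤ n := by exact_mod_cast h2n
  set θ := tilt d n with hθ
  set γ := cycleGap n / d with hγ
  set δ := gapLoss d / (n : ℝ) ^ (d + 4) with hδ
  have hδ0 : 0 < δ := by
    rw [hδ, gapLoss]
    positivity
  have hθδ : θ = 2 * γ - δ := rfl
  have hγ0 : 0 ≤ γ := by
    rw [hγ]
    have h1 := le_cycleGap (n := n) (by omega)
    have h2 : 0 ≤ 8 / (n : ℝ) ^ 2 := by positivity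
    exact div_nonneg (h2.trans h1) (Nat.cast_nonneg d)
  have hγ1 : γ ≤ 20 / (n : ℝ) ^ 2 := by
    rw [hγ]
    refine le_trans (div_le_self ?_ hd') (cycleGap_le n)
    rw [cycleGap]
    linarith [Real.cos_le_one (2 * Real.pi / n)]
  have hγ8 : γ ≤ 1 / 8 := by
    refine hγ1.trans ?_
    rw [div_le_div_iff₀ (by positivity) (by norm_num)]
    nlinarith
  have hθγ : θ ≤ 2 * γ := tilt_le
  have hx : 0 < 1 - q * θ := by nlinarith
  -- Near the gap 2λ - θ ≥ δ. For λ ≥ 2γ, (λ/2 + γ)(2λ - 2γ) = λ² + γ(λ - 2γ) ≥ λ².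
  have hterm : ∀ k : Torus d n, torusEigen k ^ 2 * ∑ m ∈ Finset.range J, q / (1 - q * θ) *
      ((1 - 2 * q * torusEigen k) / (1 - q * θ)) ^ m ≤
      (if torusEigen k < 2 * γ then 4 * γ ^ 2 / δ else 0) + (torusEigen k / 2 + γ) := by
    intro k
    have hl0 := torusEigen_nonneg k
    have hl2 := torusEigen_le_two hd k
    have hc : 0 ≤ 1 - 2 * q * torusEigen k := by nlinarith
    have hif : 0 ≤ (if torusEigen k < 2 * γ then 4 * γ ^ 2 / δ else 0) := by
      split_ifs
      · positivity
      · exact le_rfl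
    by_cases hk : k = 0
    · subst hk
      rw [torusEigen_zero] at hif ⊢
      simp only [ne_eq, OfNat.ofNat_ne_zero, not_false_eq_true, zero_pow, zero_mul]
      linarith
    have hgap : γ ≤ torusEigen k := gap_le_torusEigen hd hk
    have hlt : θ < 2 * torusEigen k := by linarith
    have hsum := mul_le_mul_of_nonneg_left (sum_geometric_tilt_le hx hc hlt J)
      (sq_nonneg (torusEigen k))
    refine hsum.trans ?_
    rw [mul_one_div]
    split_ifs with hcase
    · have : torusEigen k ^ 2 / (2 * torusEigen k - θ) ≤ 4 * γ ^ 2 / δ := by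
        refine div_le_div₀ (by positivity) ?_ hδ0 (by linarith)
        nlinarith
      linarith
    · rw [not_lt] at hcase
      rw [zero_add, div_le_iff₀ (by linarith)]
      have h1 : (torusEigen k / 2 + γ) * (2 * torusEigen k - 2 * γ) ≤
          (torusEigen k / 2 + γ) * (2 * torusEigen k - θ) := by
        refine mul_le_mul_of_nonneg_left (by linarith) (by linarith)
      nlinarith
  have hswap : ∑ m ∈ Finset.range J, q / (1 - q * θ) * torusKernel d n q θ m =
      ((n : ℝ) ^ d)⁻¹ * ∑ k : Torus d n, torusEigen k ^ 2 * ∑ m ∈ Finset.range J, q / (1 - q * θ) *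
      ((1 - 2 * q * torusEigen k) / (1 - q * θ)) ^ m := by
    simp only [torusKernel, Finset.mul_sum]
    rw [Finset.sum_comm]
    exact Finset.sum_congr rfl fun k _ => Finset.sum_congr rfl fun m _ => by ring
  have hcard := card_torusEigen_lt (n := n) hd
  rw [hswap]
  have hD : 0 < (n : ℝ) ^ d := by positivity
  rw [inv_mul_le_iff₀ hD]
  refine (Finset.sum_le_sum fun k _ => hterm k).trans ?_
  rw [Finset.sum_add_distrib, Finset.sum_add_distrib, ← Finset.sum_div,
    sum_torusEigen hd (by omega), ← Finset.sum_filter, Finset.sum_const, Finset.sum_const,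
    Finset.card_univ, card_torus, nsmul_eq_mul, nsmul_eq_mul, Nat.cast_pow]
  -- This fixes `gapLoss`: 4γ² ≤ 1600/n⁴, and 12800 = 8 · 1600.
  have h1 : 5 ^ d * (4 * γ ^ 2 / δ) ≤ (n : ℝ) ^ d * (1 / 8) := by
    have h3 : γ ^ 2 ≤ 400 / (n : ℝ) ^ 4 := by
      calc γ ^ 2 ≤ (20 / (n : ℝ) ^ 2) ^ 2 := pow_le_pow_left₀ hγ0 hγ1 2
        _ = 400 / (n : ℝ) ^ 4 := by
          rw [div_pow, ← pow_mul]
          norm_num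
    calc 5 ^ d * (4 * γ ^ 2 / δ) ≤ 5 ^ d * (4 * (400 / (n : ℝ) ^ 4) / δ) := by gcongr
      _ = (n : ℝ) ^ d * (1 / 8) := by
        rw [hδ, gapLoss, pow_add]
        field_simp
        norm_num
  have h2 : ((Finset.univ.filter fun k : Torus d n => torusEigen k < 2 * γ).card : ℝ) *
      (4 * γ ^ 2 / δ) ≤ 5 ^ d * (4 * γ ^ 2 / δ) :=
    mul_le_mul_of_nonneg_right hcard (by positivity)
  have h4 : (n : ℝ) ^ d * γ ≤ (n : ℝ) ^ d * (1 / 8) := by gcongr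
  linarith

/-- Half of the exponential turns λ² into O((1+u)^{-2}), the other half is a heat kernel of size
(1/n + (1+u)^{-1/2})^d. Passing from u to 1 + u costs e^λ ≤ e². -/
theorem sum_sq_mul_exp_le (hd : 1 ≤ d) {u : ℝ} (hu : 0 ≤ u) :
    ((n : ℝ) ^ d)⁻¹ * ∑ k : Torus d n, torusEigen k ^ 2 * Real.exp (-(u * torusEigen k)) ≤
      64 * (6 * d) ^ d * decay d n u := by
  have hn0 : (0 : ℝ) < n := Nat.cast_pos.2 (NeZero.pos n)
  set v := 1 + u with hv
  have hv0 : 0 < v := by linarith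
  have hterm : ∀ k : Torus d n, torusEigen k ^ 2 * Real.exp (-(u * torusEigen k)) ≤
      64 * (1 / Real.sqrt v) ^ 4 * Real.exp (-(v / 2 * torusEigen k)) := by
    intro k
    have hl0 := torusEigen_nonneg k
    have hl2 := torusEigen_le_two hd k
    set lam := torusEigen k
    have h1 : Real.exp (-(u * lam)) =
        Real.exp lam * Real.exp (-(v / 2 * lam)) * Real.exp (-(v / 2 * lam)) := by
      rw [← Real.exp_add, ← Real.exp_add, hv]
      congr 1
      ring
    have h2 : Real.exp lam ≤ 8 := by
      calc Real.exp lam ≤ Real.exp 2 := Real.exp_le_exp.2 hl2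
        _ = Real.exp 1 ^ 2 := by rw [← Real.exp_nat_mul]; norm_num
        _ ≤ 2.7182818286 ^ 2 := pow_le_pow_left₀ (Real.exp_nonneg _) Real.exp_one_lt_d9.le 2
        _ ≤ 8 := by norm_num
    have h3 : lam ^ 2 * Real.exp (-(v / 2 * lam)) ≤ 8 * (1 / Real.sqrt v) ^ 4 := by
      have h4 := Real.quadratic_le_exp_of_nonneg (show 0 ≤ v / 2 * lam by positivity)
      have h5 : (Real.sqrt v) ^ 4 = v ^ 2 := by
        rw [show 4 = 2 * 2 by norm_num, pow_mul, Real.sq_sqrt hv0.le]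
      have h6 : 0 ≤ v / 2 * lam := by positivity
      rw [Real.exp_neg, one_div, inv_pow, h5, ← div_eq_mul_inv, ← div_eq_mul_inv,
        div_le_div_iff₀ (Real.exp_pos _) (by positivity)]
      nlinarith
    rw [h1]
    calc lam ^ 2 * (Real.exp lam * Real.exp (-(v / 2 * lam)) * Real.exp (-(v / 2 * lam)))
        = Real.exp lam * (lam ^ 2 * Real.exp (-(v / 2 * lam))) * Real.exp (-(v / 2 * lam)) := by
          ring
      _ ≤ 8 * (8 * (1 / Real.sqrt v) ^ 4) * Real.exp (-(v / 2 * lam)) := by gcongr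
      _ = _ := by ring
  have hs0 : 0 ≤ 1 / Real.sqrt v := by positivity
  have hz0 : 0 ≤ 1 / (n : ℝ) := by positivity
  set s := 1 / Real.sqrt v with hs
  set z := 1 / (n : ℝ) with hz
  -- Both sides are compared with the power d + 4 of the larger of s and z.
  have hmax : s ^ 4 * (z + s) ^ d ≤ 2 ^ d * (s ^ (d + 4) + z ^ (d + 4)) := by
    have hm0 : 0 ≤ max s z := le_max_of_le_left hs0
    calc s ^ 4 * (z + s) ^ d ≤ max s z ^ 4 * (2 * max s z) ^ d := by
          gcongr
          · exact le_max_left _ _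
          · linarith [le_max_left s z, le_max_right s z]
      _ = 2 ^ d * max s z ^ (d + 4) := by ring
      _ ≤ 2 ^ d * (s ^ (d + 4) + z ^ (d + 4)) := by
          gcongr
          rcases max_choice s z with h | h
          · rw [h]
            exact le_add_of_nonneg_right (by positivity)
          · rw [h]
            exact le_add_of_nonneg_left (by positivity)
  calc ((n : ℝ) ^ d)⁻¹ * ∑ k : Torus d n, torusEigen k ^ 2 * Real.exp (-(u * torusEigen k))
      ≤ ((n : ℝ) ^ d)⁻¹ * ∑ k : Torus d n, 64 * s ^ 4 * Real.exp (-(v / 2 * torusEigen k)) := by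
        exact mul_le_mul_of_nonneg_left (Finset.sum_le_sum fun k _ => hterm k) (by positivity)
    _ = 64 * s ^ 4 * (((n : ℝ) ^ d)⁻¹ * ∑ k : Torus d n, Real.exp (-(v / 2 * torusEigen k))) := by
        rw [← Finset.mul_sum]
        ring
    _ ≤ 64 * s ^ 4 * (3 * d * (z + s)) ^ d := by
        gcongr
        exact sum_exp_torusEigen_le hd hv0
    _ = 64 * (3 * d) ^ d * (s ^ 4 * (z + s) ^ d) := by
        rw [mul_pow]
        ring
    _ ≤ 64 * (3 * d) ^ d * (2 ^ d * (s ^ (d + 4) + z ^ (d + 4))) := by gcongr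
    _ = 64 * (6 * d) ^ d * decay d n u := by
        rw [show (6 : ℝ) * d = 2 * (3 * d) by ring, mul_pow 2]
        simp only [decay]
        ring

/-- The constant in the bound of the kernel by the decay profile. -/
def kernelConst (d : ℕ) : ℝ := 64 * (6 * d) ^ d + 1600 * 5 ^ d

/-- For the few modes near the gap the tilted ratio is only known to be at most 1, which leaves the
constant n^{-d} · 5^d · 4γ² = O(n^{-(d+4)}). The other modes keep half of their decay. -/
theorem torusKernel_le (hd : 1 ≤ d) (hn : 12800 * 5 ^ d * d ≤ n) {q : ℝ} (hq : 0 < q)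
    (hq1 : q ≤ 1 / 8) (m : ℕ) :
    torusKernel d n q (tilt d n) m ≤ kernelConst d * decay d n (q * m) := by
  classical
  have hd' : (1 : ℝ) ≤ d := by exact_mod_cast hd
  have hn0 : (0 : ℝ) < n := Nat.cast_pos.2 (NeZero.pos n)
  set θ := tilt d n with hθ
  set γ := cycleGap n / d with hγ
  have hcg : 0 ≤ cycleGap n := by
    rw [cycleGap]
    linarith [Real.cos_le_one (2 * Real.pi / n)]
  have hcg2 : cycleGap n ≤ 2 := by
    rw [cycleGap]
    linarith [Real.neg_one_le_cos (2 * Real.pi / n)]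
  have hγ0 : 0 ≤ γ := by positivity
  have hγc : γ ≤ cycleGap n := div_le_self hcg hd'
  have hγ1 : γ ≤ 20 / (n : ℝ) ^ 2 := hγc.trans (cycleGap_le n)
  have hθγ : θ ≤ 2 * γ := tilt_le
  have hθ0 : 0 ≤ θ := hγ0.trans (le_tilt hd hn)
  have hx : 0 < 1 - q * θ := by nlinarith
  have hx1 : 1 - q * θ ≤ 1 := by nlinarith
  have hterm : ∀ k : Torus d n, torusEigen k ^ 2 *
      ((1 - 2 * q * torusEigen k) / (1 - q * θ)) ^ m ≤
      (if torusEigen k < 2 * γ then 4 * γ ^ 2 else 0) +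
        torusEigen k ^ 2 * Real.exp (-(q * m * torusEigen k)) := by
    intro k
    have hl0 := torusEigen_nonneg k
    have hl2 := torusEigen_le_two hd k
    have hc : 0 ≤ 1 - 2 * q * torusEigen k := by nlinarith
    have hr0 : 0 ≤ (1 - 2 * q * torusEigen k) / (1 - q * θ) := div_nonneg hc hx.le
    have he : 0 ≤ torusEigen k ^ 2 * Real.exp (-(q * m * torusEigen k)) := by positivity
    by_cases hk : k = 0
    · subst hk
      rw [torusEigen_zero] at he ⊢
      have hif : 0 ≤ (if (0 : ℝ) < 2 * γ then 4 * γ ^ 2 else 0) := by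
        split_ifs
        · positivity
        · exact le_rfl
      simp only [ne_eq, OfNat.ofNat_ne_zero, not_false_eq_true, zero_pow, zero_mul]
      linarith
    have hgap : γ ≤ torusEigen k := gap_le_torusEigen hd hk
    split_ifs with hcase
    · have hr1 : (1 - 2 * q * torusEigen k) / (1 - q * θ) ≤ 1 := by
        rw [div_le_one hx]
        nlinarith
      have h1 : torusEigen k ^ 2 * ((1 - 2 * q * torusEigen k) / (1 - q * θ)) ^ m ≤
          torusEigen k ^ 2 * 1 :=
        mul_le_mul_of_nonneg_left (pow_le_one₀ hr0 hr1) (sq_nonneg _)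
      nlinarith
    · rw [not_lt] at hcase
      rw [zero_add]
      refine mul_le_mul_of_nonneg_left ?_ (sq_nonneg _)
      -- Since λ ≥ 2γ ≥ θ, 1 - 2qλ ≤ (1 - qλ)(1 - qθ).
      have h1 : (1 - 2 * q * torusEigen k) / (1 - q * θ) ≤ Real.exp (-(q * torusEigen k)) := by
        refine le_trans ?_ (Real.one_sub_le_exp_neg _)
        rw [div_le_iff₀ hx]
        have h2 : 0 ≤ q * (torusEigen k - θ) := mul_nonneg hq.le (by linarith)
        have h3 : 0 ≤ q * torusEigen k * (q * θ) := by positivity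
        nlinarith
      calc _ ≤ Real.exp (-(q * torusEigen k)) ^ m := pow_le_pow_left₀ hr0 h1 m
        _ = Real.exp (-(q * m * torusEigen k)) := by
          rw [← Real.exp_nat_mul]
          congr 1
          ring
  have hcard := card_torusEigen_lt (n := n) hd
  have hmain := sum_sq_mul_exp_le (n := n) hd (show 0 ≤ q * m by positivity)
  rw [torusKernel]
  calc _ ≤ ((n : ℝ) ^ d)⁻¹ * ∑ k : Torus d n, ((if torusEigen k < 2 * γ then 4 * γ ^ 2 else 0) +
        torusEigen k ^ 2 * Real.exp (-(q * m * torusEigen k))) := by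
        gcongr with k
        exact hterm k
    _ = ((n : ℝ) ^ d)⁻¹ * (((Finset.univ.filter fun k : Torus d n =>
          torusEigen k < 2 * γ).card : ℝ) * (4 * γ ^ 2)) + ((n : ℝ) ^ d)⁻¹ *
        ∑ k : Torus d n, torusEigen k ^ 2 * Real.exp (-(q * m * torusEigen k)) := by
        rw [Finset.sum_add_distrib, ← Finset.sum_filter, Finset.sum_const, nsmul_eq_mul, mul_add]
    _ ≤ 1600 * 5 ^ d * (1 / (n : ℝ)) ^ (d + 4) + 64 * (6 * d) ^ d * decay d n (q * m) := by
        refine add_le_add ?_ hmain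
        calc _ ≤ ((n : ℝ) ^ d)⁻¹ * (5 ^ d * (4 * (20 / (n : ℝ) ^ 2) ^ 2)) := by gcongr
          _ = 1600 * 5 ^ d * (1 / (n : ℝ)) ^ (d + 4) := by
            rw [one_div, inv_pow, pow_add]
            field_simp
            norm_num
    _ ≤ kernelConst d * decay d n (q * m) := by
        have h1 : (1 / (n : ℝ)) ^ (d + 4) ≤ decay d n (q * m) := by
          rw [decay]
          exact le_add_of_nonneg_left (by positivity)
        have h2 : 1600 * 5 ^ d * (1 / (n : ℝ)) ^ (d + 4) ≤
            1600 * 5 ^ d * decay d n (q * m) := by gcongr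
        rw [kernelConst]
        linarith

end Kernel

/-! ### Discrete renewal inequalities with mass 3/4. -/

section Renewal

theorem sum_renewal_le {F G κ : ℕ → ℝ} (hF0 : ∀ j, 0 ≤ F j)
    (hF : ∀ j, F j ≤ G j + ∑ i ∈ Finset.range j, κ (j - 1 - i) * F i)
    (hκ : ∀ J, ∑ m ∈ Finset.range J, κ m ≤ 3 / 4) (J : ℕ) :
    ∑ j ∈ Finset.range J, F j ≤ 4 * ∑ j ∈ Finset.range J, G j := by
  have h1 : ∑ j ∈ Finset.range J, ∑ i ∈ Finset.range j, κ (j - 1 - i) * F i =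
      ∑ i ∈ Finset.range J, (∑ j ∈ Finset.Ico (i + 1) J, κ (j - 1 - i)) * F i := by
    simp only [Finset.sum_mul]
    refine Finset.sum_comm' fun j i => ?_
    simp only [Finset.mem_range, Finset.mem_Ico]
    omega
  have h2 : ∀ i, ∑ j ∈ Finset.Ico (i + 1) J, κ (j - 1 - i) ≤ 3 / 4 := by
    intro i
    rw [Finset.sum_Ico_eq_sum_range]
    refine le_trans (le_of_eq (Finset.sum_congr rfl fun m _ => ?_)) (hκ (J - (i + 1)))
    congr 1
    omega
  have h3 : ∑ i ∈ Finset.range J, (∑ j ∈ Finset.Ico (i + 1) J, κ (j - 1 - i)) * F i ≤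
      3 / 4 * ∑ i ∈ Finset.range J, F i := by
    rw [Finset.mul_sum]
    exact Finset.sum_le_sum fun i _ => mul_le_mul_of_nonneg_right (h2 i) (hF0 i)
  have h4 := Finset.sum_le_sum fun j (_ : j ∈ Finset.range J) => hF j
  rw [Finset.sum_add_distrib, h1] at h4
  linarith

/-- Split the convolution at `s j`. Early indices have a long lag, so κ is O(w j) there and F is
summed by `S`. Late indices have w comparable to w j, so induction applies with factor 3/4 · 7/6 =
7/8; the missing 1/8 is the reason for the constant 8. -/
theorem renewal_le {F w κ : ℕ → ℝ} {s : ℕ → ℕ} {a b c S : ℝ} (hF0 : ∀ j, 0 ≤ F j)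
    (hκ0 : ∀ j, 0 ≤ κ j) (hw0 : ∀ j, 0 ≤ w j) (ha : 0 ≤ a) (hb : 0 ≤ b) (hc : 0 ≤ c)
    (hF : ∀ j, F j ≤ a * w j + ∑ i ∈ Finset.range j, κ (j - 1 - i) * F i)
    (hκ : ∀ J, ∑ m ∈ Finset.range J, κ m ≤ 3 / 4) (hκw : ∀ m, κ m ≤ c * w m)
    (hS : ∀ J, ∑ j ∈ Finset.range J, F j ≤ S) (hs : ∀ j, s j ≤ j)
    (hearly : ∀ j, ∀ i < s j, w (j - 1 - i) ≤ b * w j)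
    (hlate : ∀ j i, s j ≤ i → i < j → w i ≤ 7 / 6 * w j) (j : ℕ) :
    F j ≤ 8 * (a + c * b * S) * w j := by
  have hS0 : 0 ≤ S := by simpa using hS 0
  induction j using Nat.strong_induction_on with
  | _ j ih =>
    have hsplit : ∑ i ∈ Finset.range j, κ (j - 1 - i) * F i =
        ∑ i ∈ Finset.range (s j), κ (j - 1 - i) * F i +
          ∑ i ∈ Finset.Ico (s j) j, κ (j - 1 - i) * F i :=
      (Finset.sum_range_add_sum_Ico _ (hs j)).symm
    have h1 : ∑ i ∈ Finset.range (s j), κ (j - 1 - i) * F i ≤ c * b * S * w j := by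
      calc _ ≤ ∑ i ∈ Finset.range (s j), c * (b * w j) * F i := by
            refine Finset.sum_le_sum fun i hi => mul_le_mul_of_nonneg_right ?_ (hF0 i)
            exact (hκw _).trans
              (mul_le_mul_of_nonneg_left (hearly j i (Finset.mem_range.1 hi)) hc)
        _ = c * (b * w j) * ∑ i ∈ Finset.range (s j), F i := by rw [Finset.mul_sum]
        _ ≤ c * (b * w j) * S :=
            mul_le_mul_of_nonneg_left (hS _) (mul_nonneg hc (mul_nonneg hb (hw0 j)))
        _ = c * b * S * w j := by ring
    have hA0 : 0 ≤ 8 * (a + c * b * S) := by positivity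
    have h2 : ∑ i ∈ Finset.Ico (s j) j, κ (j - 1 - i) * F i ≤
        3 / 4 * (8 * (a + c * b * S) * (7 / 6 * w j)) := by
      calc _ ≤ ∑ i ∈ Finset.Ico (s j) j,
              κ (j - 1 - i) * (8 * (a + c * b * S) * (7 / 6 * w j)) := by
            refine Finset.sum_le_sum fun i hi => mul_le_mul_of_nonneg_left ?_ (hκ0 _)
            rw [Finset.mem_Ico] at hi
            exact (ih i hi.2).trans (mul_le_mul_of_nonneg_left (hlate j i hi.1 hi.2) hA0)
        _ ≤ _ := by
            rw [← Finset.sum_mul]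
            refine mul_le_mul_of_nonneg_right ?_ (mul_nonneg hA0 (mul_nonneg (by norm_num) (hw0 j)))
            refine le_trans ?_ (hκ j)
            refine le_trans (Finset.sum_le_sum_of_subset_of_nonneg
              (t := Finset.range j) (fun i hi => ?_) fun i _ _ => hκ0 _) ?_
            · exact Finset.mem_range.2 (Finset.mem_Ico.1 hi).2
            · exact (Finset.sum_range_reflect κ j).le
    have h3 := hF j
    rw [hsplit] at h3
    linarith

end Renewal

/-! ### Decay of the dissipation and of the increments of the sum. -/

section SecondMoment

variable {d n : ℕ} [NeZero n]

/-- Duhamel's formula for the recursion of `chainOp_normSq_torusFourier`. -/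
theorem chainOp_pow_normSq_torusFourier (hd : 1 ≤ d) (hn : 3 ≤ n) (q : ℝ) (k : Torus d n)
    (y : Torus d n → ℝ) (j : ℕ) :
    (chainOp (torusWalk d n) q ^ j) (fun y => Complex.normSq (torusFourier y k)) y =
      (1 - 2 * q * torusEigen k) ^ j * Complex.normSq (torusFourier y k) +
      ∑ i ∈ Finset.range j, q * (1 - 2 * q * torusEigen k) ^ (j - 1 - i) *
        (chainOp (torusWalk d n) q ^ i) (dissipation (torusWalk d n)) y := by
  induction j with
  | zero => simp
  | succ j ih =>
    rw [pow_succ, Module.End.mul_apply, chainOp_normSq_torusFourier hd hn, map_add, map_smul,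
      map_smul]
    simp only [Pi.add_apply, Pi.smul_apply, smul_eq_mul]
    rw [ih, Finset.sum_range_succ, mul_add, Finset.mul_sum]
    have h : ∀ i ∈ Finset.range j, (1 - 2 * q * torusEigen k) *
        (q * (1 - 2 * q * torusEigen k) ^ (j - 1 - i) *
          (chainOp (torusWalk d n) q ^ i) (dissipation (torusWalk d n)) y) =
        q * (1 - 2 * q * torusEigen k) ^ (j + 1 - 1 - i) *
          (chainOp (torusWalk d n) q ^ i) (dissipation (torusWalk d n)) y := by
      intro i hi
      rw [Finset.mem_range] at hi
      have hji : j + 1 - 1 - i = (j - 1 - i) + 1 := by omega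
      rw [hji, pow_succ]
      ring
    rw [Finset.sum_congr rfl h]
    simp only [Nat.add_sub_cancel, Nat.sub_self, pow_zero]
    ring

/-- Weighting Duhamel's formula by λ_k² and summing over k closes it in the dissipation alone; only
the initial term is estimated. -/
theorem chainOp_pow_dissipation_le (hd : 1 ≤ d) (hn : 3 ≤ n) {q θ : ℝ} (hq0 : 0 ≤ q)
    (hq1 : q ≤ 1 / 4) (hx : 0 < 1 - q * θ) (y : Torus d n → ℝ) (j : ℕ) :
    (chainOp (torusWalk d n) q ^ j) (dissipation (torusWalk d n)) y / (1 - q * θ) ^ j ≤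
      (∑ i, |y i|) ^ 2 * torusKernel d n q θ j +
      ∑ i ∈ Finset.range j, (q / (1 - q * θ) * torusKernel d n q θ (j - 1 - i)) *
        ((chainOp (torusWalk d n) q ^ i) (dissipation (torusWalk d n)) y / (1 - q * θ) ^ i) := by
  set x := 1 - q * θ with hxdef
  set T := chainOp (torusWalk d n) q with hT
  have hdis : dissipation (torusWalk d n) = ((n : ℝ) ^ d)⁻¹ • ∑ k : Torus d n,
      torusEigen k ^ 2 • fun y => Complex.normSq (torusFourier y k) := by
    funext y
    rw [dissipation_eq_sum hd hn]
    simp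
  have hF : (T ^ j) (dissipation (torusWalk d n)) y = ((n : ℝ) ^ d)⁻¹ * ∑ k : Torus d n,
      torusEigen k ^ 2 * ((1 - 2 * q * torusEigen k) ^ j * Complex.normSq (torusFourier y k) +
      ∑ i ∈ Finset.range j, q * (1 - 2 * q * torusEigen k) ^ (j - 1 - i) *
        (T ^ i) (dissipation (torusWalk d n)) y) := by
    conv_lhs => rw [hdis]
    rw [map_smul, map_sum]
    simp only [map_smul, Pi.smul_apply, smul_eq_mul, Finset.sum_apply]
    congr 1
    refine Finset.sum_congr rfl fun k _ => ?_
    rw [hT, chainOp_pow_normSq_torusFourier hd hn]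
  have h1 : (T ^ j) (dissipation (torusWalk d n)) y / x ^ j = ((n : ℝ) ^ d)⁻¹ * ∑ k : Torus d n,
      torusEigen k ^ 2 * (((1 - 2 * q * torusEigen k) / x) ^ j *
        Complex.normSq (torusFourier y k)) +
      ∑ i ∈ Finset.range j, (q / x * torusKernel d n q θ (j - 1 - i)) *
        ((T ^ i) (dissipation (torusWalk d n)) y / x ^ i) := by
    rw [hF, mul_div_assoc, Finset.sum_div]
    simp only [mul_add, Finset.sum_add_distrib, add_div]
    congr 1
    · congr 1
      refine Finset.sum_congr rfl fun k _ => ?_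
      rw [div_pow]
      field_simp
    · rw [← Finset.sum_div]
      simp only [torusKernel, Finset.mul_sum, Finset.sum_mul]
      rw [Finset.sum_comm, Finset.sum_div, Finset.mul_sum]
      refine Finset.sum_congr rfl fun i hi => ?_
      rw [Finset.sum_div, Finset.mul_sum]
      refine Finset.sum_congr rfl fun k _ => ?_
      rw [Finset.mem_range] at hi
      -- The lag is j - 1 - i, one less than j - i; the spare factor x is the denominator of q / x.
      have hj : x ^ j = x * x ^ (j - 1 - i) * x ^ i := by
        rw [← pow_succ', ← pow_add]
        congr 1
        omega
      rw [hj, div_pow, ← hxdef]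
      have hx0 := hx.ne'
      field_simp
  rw [h1]
  refine add_le_add_left ?_ _
  rw [torusKernel, mul_left_comm]
  refine mul_le_mul_of_nonneg_left ?_ (by positivity)
  rw [Finset.mul_sum]
  refine Finset.sum_le_sum fun k _ => ?_
  have hr : 0 ≤ (1 - 2 * q * torusEigen k) / x := by
    have := torusEigen_le_two hd k
    have := torusEigen_nonneg k
    exact div_nonneg (by nlinarith) hx.le
  calc torusEigen k ^ 2 * (((1 - 2 * q * torusEigen k) / x) ^ j *
        Complex.normSq (torusFourier y k)) ≤ torusEigen k ^ 2 *
        (((1 - 2 * q * torusEigen k) / x) ^ j * (∑ i, |y i|) ^ 2) := by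
        gcongr
        exact normSq_torusFourier_le y k
    _ = _ := by ring

/-- The constant in the bound of the second moments. -/
noncomputable def momentConst (d : ℕ) : ℝ :=
  8 * (kernelConst d + 6 * kernelConst d * (1 / (1 / (7 * (d + 4)))) ^ (d + 4))

theorem momentConst_pos (d : ℕ) : 0 < momentConst d := by
  unfold momentConst kernelConst
  positivity

theorem torusKernel_nonneg (hd : 1 ≤ d) {q θ : ℝ} (hq0 : 0 ≤ q) (hq1 : q ≤ 1 / 4)
    (hx : 0 < 1 - q * θ) (m : ℕ) : 0 ≤ torusKernel d n q θ m := by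
  refine mul_nonneg (by positivity) (Finset.sum_nonneg fun k _ => ?_)
  have := torusEigen_le_two hd k
  have := torusEigen_nonneg k
  exact mul_nonneg (sq_nonneg _) (pow_nonneg (div_nonneg (by nlinarith) hx.le) _)

theorem tilt_bounds (hd : 1 ≤ d) (hn : 12800 * 5 ^ d * d ≤ n) :
    0 < tilt d n ∧ tilt d n ≤ 4 ∧ 1 / tilt d n ≤ d * (n : ℝ) ^ 2 / 8 := by
  have hd' : (1 : ℝ) ≤ d := by exact_mod_cast hd
  have hn0 : (0 : ℝ) < n := Nat.cast_pos.2 (NeZero.pos n)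
  have h2 : 2 ≤ n := by
    have : 1 ≤ 5 ^ d * d := Nat.mul_pos (by positivity) hd
    nlinarith
  have h1 : 8 / (n : ℝ) ^ 2 / d ≤ tilt d n :=
    (div_le_div_of_nonneg_right (le_cycleGap h2) (by positivity)).trans (le_tilt hd hn)
  have h0 : 0 < 8 / (n : ℝ) ^ 2 / d := by positivity
  refine ⟨h0.trans_le h1, ?_, ?_⟩
  · refine tilt_le.trans ?_
    have h3 : cycleGap n ≤ 2 := by
      rw [cycleGap]
      linarith [Real.neg_one_le_cos (2 * Real.pi / n)]
    have h4 : 0 ≤ cycleGap n := by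
      rw [cycleGap]
      linarith [Real.cos_le_one (2 * Real.pi / n)]
    linarith [div_le_self h4 hd']
  · refine (one_div_le_one_div_of_le h0 h1).trans (le_of_eq ?_)
    field_simp

/-- The choice η = 1/(7(d+4)) makes (1 - η)^{d+4} ≥ 6/7 by Bernoulli, so the profile varies by at
most 7/6 over the last fraction η of the time. -/
theorem chainOp_pow_dissipation_le_decay (hd : 1 ≤ d) (hn : 12800 * 5 ^ d * d ≤ n) {q : ℝ}
    (hq0 : 0 < q) (hq1 : q ≤ 1 / (7 * (d + 4))) (hcard : Fintype.card (Torus d n) * q ≤ 1)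
    (y : Torus d n → ℝ) (j : ℕ) :
    (chainOp (torusWalk d n) q ^ j) (dissipation (torusWalk d n)) y ≤
      momentConst d * (∑ i, |y i|) ^ 2 * decay d n (q * j) * (1 - q * tilt d n) ^ j := by
  have hd' : (1 : ℝ) ≤ d := by exact_mod_cast hd
  set η : ℝ := 1 / (7 * (d + 4)) with hη
  have hη0 : 0 < η := by positivity
  have hη1 : η ≤ 1 / 35 := by
    rw [hη]
    exact one_div_le_one_div_of_le (by norm_num) (by linarith)
  have hn3 : 3 ≤ n := by
    have : 1 ≤ 5 ^ d * d := Nat.mul_pos (by positivity) hd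
    nlinarith
  obtain ⟨hθ0, hθ4, -⟩ := tilt_bounds (n := n) hd hn
  set θ := tilt d n with hθ
  have hx : 1 / 2 ≤ 1 - q * θ := by nlinarith
  have hx0 : 0 < 1 - q * θ := by linarith
  set M := (∑ i, |y i|) ^ 2 with hM
  have hM0 : 0 ≤ M := sq_nonneg _
  have hC0 : 0 ≤ kernelConst d := by
    unfold kernelConst
    positivity
  set F : ℕ → ℝ := fun j =>
    (chainOp (torusWalk d n) q ^ j) (dissipation (torusWalk d n)) y / (1 - q * θ) ^ j with hF
  have hF0 : ∀ j, 0 ≤ F j := fun j =>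
    div_nonneg (chainOp_pow_nonneg _ hq0.le hcard j (dissipation_nonneg _) y) (by positivity)
  have hK0 : ∀ m, 0 ≤ torusKernel d n q θ m :=
    torusKernel_nonneg hd hq0.le (by linarith) hx0
  have hK : ∀ m, torusKernel d n q θ m ≤ kernelConst d * decay d n (q * m) :=
    torusKernel_le hd hn hq0 (by linarith)
  have hsumK : ∀ J, ∑ m ∈ Finset.range J, q / (1 - q * θ) * torusKernel d n q θ m ≤ 3 / 4 :=
    sum_torusKernel_le hd hn hq0 (by linarith)
  have hqx : q / (1 - q * θ) ≤ 2 * q := by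
    rw [div_le_iff₀ hx0]
    nlinarith
  have hqx0 : 0 < q / (1 - q * θ) := div_pos hq0 hx0
  have hren : ∀ j, F j ≤ M * torusKernel d n q θ j + ∑ i ∈ Finset.range j,
      (q / (1 - q * θ) * torusKernel d n q θ (j - 1 - i)) * F i :=
    chainOp_pow_dissipation_le hd hn3 hq0.le (by linarith) hx0 y
  have hS : ∀ J, ∑ j ∈ Finset.range J, F j ≤ 3 * M / q := by
    intro J
    refine (sum_renewal_le hF0 hren hsumK J).trans ?_
    have h1 := hsumK J
    rw [← Finset.mul_sum] at h1 ⊢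
    have h2 : q ≤ q / (1 - q * θ) := by
      rw [le_div_iff₀ hx0]
      nlinarith [mul_pos hq0 (mul_pos hq0 hθ0)]
    have h3 : 0 ≤ ∑ m ∈ Finset.range J, torusKernel d n q θ m :=
      Finset.sum_nonneg fun m _ => hK0 m
    rw [le_div_iff₀ hq0]
    have h4 : q * ∑ m ∈ Finset.range J, torusKernel d n q θ m ≤ 3 / 4 :=
      (mul_le_mul_of_nonneg_right h2 h3).trans h1
    nlinarith
  -- The factor q in `c` cancels the 1/q in `S`, so the bound does not depend on the mesh.
  have hmain := renewal_le (F := F) (w := fun j => decay d n (q * j))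
    (κ := fun m => q / (1 - q * θ) * torusKernel d n q θ m) (s := fun j => ⌊(1 - η) * j⌋₊)
    (a := M * kernelConst d) (b := (1 / η) ^ (d + 4)) (c := 2 * q * kernelConst d)
    (S := 3 * M / q) hF0 (fun j => mul_nonneg hqx0.le (hK0 j)) (fun j => decay_nonneg _)
    (by positivity) (by positivity) (by positivity) ?_ hsumK ?_ hS ?_ ?_ ?_ j
  · have hcoef : 8 * (M * kernelConst d + 2 * q * kernelConst d * (1 / η) ^ (d + 4) *
        (3 * M / q)) = momentConst d * M := by
      rw [momentConst, ← hη]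
      field_simp
      ring
    rw [hcoef, hF, div_le_iff₀ (by positivity)] at hmain
    exact hmain
  · intro j
    refine (hren j).trans (add_le_add_left ?_ _)
    rw [mul_assoc]
    exact mul_le_mul_of_nonneg_left (hK j) hM0
  · intro m
    calc q / (1 - q * θ) * torusKernel d n q θ m ≤
        2 * q * (kernelConst d * decay d n (q * m)) :=
          mul_le_mul hqx (hK m) (hK0 m) (by positivity)
      _ = _ := by ring
  · intro j
    have h1 : (1 - η) * j ≤ j := by nlinarith [Nat.cast_nonneg (α := ℝ) j]
    exact Nat.floor_le_of_le h1
  · intro j i hi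
    have h1 : (i : ℝ) + 1 ≤ (1 - η) * j := by
      have h2 : i + 1 ≤ ⌊(1 - η) * (j : ℝ)⌋₊ := hi
      have h3 : ((i + 1 : ℕ) : ℝ) ≤ (1 - η) * j :=
        (Nat.le_floor_iff (mul_nonneg (by linarith) (Nat.cast_nonneg _))).1 h2
      exact_mod_cast h3
    have h0 : (i : ℝ) + 1 ≤ j := by nlinarith [Nat.cast_nonneg (α := ℝ) j]
    have h0' : i + 1 ≤ j := by exact_mod_cast h0
    have h4 : ((j - 1 - i : ℕ) : ℝ) = j - 1 - i := by
      rw [Nat.cast_sub (by omega), Nat.cast_sub (by omega), Nat.cast_one]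
    refine decay_le_mul hη0 (by linarith) (by positivity) ?_
    rw [h4]
    nlinarith [mul_nonneg hq0.le (show 0 ≤ (1 - η) * j - (i + 1) by linarith)]
  · intro j i hi hij
    have h1 : (1 - η) * j ≤ i + 1 := by
      have h2 := Nat.lt_floor_add_one ((1 - η) * (j : ℝ))
      have h3 : ((⌊(1 - η) * (j : ℝ)⌋₊ : ℕ) : ℝ) ≤ i := by exact_mod_cast hi
      linarith
    have hj0 : (0 : ℝ) ≤ q * j := by positivity
    -- The floor loses one step, of length q; the loss is absorbed because q ≤ η.
    have h3 := decay_le_mul (d := d) (n := n) (c := 1 - η) (u := q * j) (w := q * i)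
      (by linarith) (by linarith) hj0 (by nlinarith)
    refine h3.trans (mul_le_mul_of_nonneg_right ?_ (decay_nonneg _))
    have h5 := one_add_mul_le_pow (show (-2 : ℝ) ≤ -η by linarith) (d + 4)
    have h6 : ((d + 4 : ℕ) : ℝ) * η = 1 / 7 := by
      rw [hη]
      push_cast
      field_simp
    have h7 : (6 : ℝ) / 7 ≤ (1 - η) ^ (d + 4) := by
      rw [← sub_eq_add_neg] at h5
      nlinarith
    rw [one_div, inv_pow]
    calc ((1 - η) ^ (d + 4))⁻¹ ≤ (6 / 7 : ℝ)⁻¹ := inv_anti₀ (by norm_num) h7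
      _ = 7 / 6 := by norm_num

/-- The bound of the increments of the sum of the configuration, at time `τ`. -/
noncomputable def incrementBound (d n : ℕ) (τ : ℝ) : ℝ :=
  momentConst d * (2 + d) * ((1 / Real.sqrt (1 + τ)) ^ (d + 2) + (1 / (n : ℝ)) ^ (d + 2)) *
    Real.exp (-(tilt d n * τ))

/-- A telescoping comparison with ∫ du/u²; the 2 pays for v + q ≤ 2v. -/
theorem sum_inv_sq_le {q u : ℝ} (hq0 : 0 ≤ q) (hq1 : q ≤ 1) (hu : 1 ≤ u) (m : ℕ) :
    ∑ j ∈ Finset.range m, q / (u + q * j) ^ 2 ≤ 2 / u - 2 / (u + q * m) := by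
  induction m with
  | zero => simp
  | succ m ih =>
    rw [Finset.sum_range_succ]
    have hv : 1 ≤ u + q * m := by nlinarith [mul_nonneg hq0 (Nat.cast_nonneg (α := ℝ) m)]
    set v := u + q * m with hvdef
    have h1 : u + q * (m + 1 : ℕ) = v + q := by
      rw [hvdef]
      push_cast
      ring
    have h2 : q / v ^ 2 ≤ 2 / v - 2 / (v + q) := by
      rw [div_sub_div _ _ (by linarith) (by linarith),
        div_le_div_iff₀ (by positivity) (by positivity)]
      have h3 : 0 ≤ q * v * (v - q) :=
        mul_nonneg (mul_nonneg hq0 (by linarith)) (by linarith)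
      nlinarith
    rw [h1]
    linarith

/-- The bound is uniform in `m`, as needed to send the later time to infinity. In the power term σ^d
is pulled out and 1/u² is summed; in the constant term the tilt is summed to 1/θ. -/
theorem chainOp_pow_increment_le (hd : 1 ≤ d) (hn : 12800 * 5 ^ d * d ≤ n) {q : ℝ}
    (hq0 : 0 < q) (hq1 : q ≤ 1 / (7 * (d + 4))) (hcard : Fintype.card (Torus d n) * q ≤ 1)
    (y : Torus d n → ℝ) (a m : ℕ) :
    q * ∑ j ∈ Finset.range m,
        (chainOp (torusWalk d n) q ^ (a + j)) (dissipation (torusWalk d n)) y ≤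
      (∑ i, |y i|) ^ 2 * incrementBound d n (q * a) := by
  have hd' : (1 : ℝ) ≤ d := by exact_mod_cast hd
  have hn0 : (0 : ℝ) < n := Nat.cast_pos.2 (NeZero.pos n)
  have hη1 : (1 : ℝ) / (7 * (d + 4)) ≤ 1 / 35 :=
    one_div_le_one_div_of_le (by norm_num) (by linarith)
  obtain ⟨hθ0, hθ4, hθi⟩ := tilt_bounds (n := n) hd hn
  set θ := tilt d n with hθ
  have hx0 : 0 < 1 - q * θ := by nlinarith
  have hx1 : 1 - q * θ ≤ 1 := by nlinarith [mul_pos hq0 hθ0]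
  set x := 1 - q * θ with hx
  set M := (∑ i, |y i|) ^ 2 with hM
  have hM0 : 0 ≤ M := sq_nonneg _
  have hA := momentConst_pos d
  set u : ℝ := 1 + q * a with hu
  have hu1 : 1 ≤ u := by
    rw [hu]
    have : 0 ≤ q * a := by positivity
    linarith
  set σ := 1 / Real.sqrt u with hσ
  have hσ0 : 0 ≤ σ := by positivity
  set z := 1 / (n : ℝ) with hz
  have hterm : ∀ j : ℕ, q * (chainOp (torusWalk d n) q ^ (a + j)) (dissipation (torusWalk d n)) y ≤
      momentConst d * M * x ^ a * (σ ^ d * (q / (u + q * j) ^ 2) + z ^ (d + 4) * (q * x ^ j)) := by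
    intro j
    have h1 := chainOp_pow_dissipation_le_decay hd hn hq0 hq1 hcard y (a + j)
    have hw : (1 : ℝ) + q * (a + j : ℕ) = u + q * j := by
      rw [hu]
      push_cast
      ring
    have hqj : 0 ≤ q * j := by positivity
    have huj : 0 < u + q * j := by linarith
    have hroot : (1 / Real.sqrt (u + q * j)) ^ (d + 4) ≤ σ ^ d * (1 / (u + q * j) ^ 2) := by
      rw [pow_add]
      have e1 : (1 / Real.sqrt (u + q * j)) ^ 4 = 1 / (u + q * j) ^ 2 := by
        rw [div_pow, one_pow, show 4 = 2 * 2 by norm_num, pow_mul, Real.sq_sqrt huj.le]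
      rw [e1]
      gcongr
      exact one_div_le_one_div_of_le (Real.sqrt_pos.2 (by linarith))
        (Real.sqrt_le_sqrt (by linarith))
    rw [decay, hw] at h1
    have hxj : 0 < x ^ j := by positivity
    have hxj1 : x ^ j ≤ 1 := pow_le_one₀ hx0.le hx1
    calc q * (chainOp (torusWalk d n) q ^ (a + j)) (dissipation (torusWalk d n)) y
        ≤ q * (momentConst d * M * ((1 / Real.sqrt (u + q * j)) ^ (d + 4) + z ^ (d + 4)) *
            x ^ (a + j)) := mul_le_mul_of_nonneg_left h1 hq0.le
      _ = momentConst d * M * x ^ a * (q * (1 / Real.sqrt (u + q * j)) ^ (d + 4) * x ^ j +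
            z ^ (d + 4) * (q * x ^ j)) := by
          rw [pow_add]
          ring
      _ ≤ momentConst d * M * x ^ a * (q * (σ ^ d * (1 / (u + q * j) ^ 2)) * 1 +
            z ^ (d + 4) * (q * x ^ j)) := by gcongr
      _ = _ := by ring
  have hgeo : ∑ j ∈ Finset.range m, q * x ^ j ≤ d * (n : ℝ) ^ 2 / 8 := by
    refine le_trans ?_ hθi
    rw [← Finset.mul_sum, le_div_iff₀ hθ0]
    have h1 := geom_sum_mul_neg x m
    have h2 : 0 < x ^ m := by positivity
    have h3 : 1 - x = q * θ := by rw [hx]; ring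
    rw [h3] at h1
    linarith
  have hinv : ∑ j ∈ Finset.range m, q / (u + q * j) ^ 2 ≤ 2 * σ ^ 2 := by
    have h1 := sum_inv_sq_le hq0.le (by linarith) hu1 m
    have h2 : 0 ≤ 2 / (u + q * m) := by positivity
    have h3 : σ ^ 2 = 1 / u := by
      rw [hσ, div_pow, one_pow, Real.sq_sqrt (by linarith)]
    rw [h3]
    calc _ ≤ 2 / u - 2 / (u + q * m) := h1
      _ ≤ 2 / u := by linarith
      _ = 2 * (1 / u) := by ring
  have hxa : x ^ a ≤ Real.exp (-(θ * (q * a))) := by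
    calc x ^ a ≤ Real.exp (-(q * θ)) ^ a :=
          pow_le_pow_left₀ hx0.le (Real.one_sub_le_exp_neg _) a
      _ = _ := by
          rw [← Real.exp_nat_mul]
          congr 1
          ring
  rw [Finset.mul_sum]
  calc _ ≤ ∑ j ∈ Finset.range m, momentConst d * M * x ^ a *
        (σ ^ d * (q / (u + q * j) ^ 2) + z ^ (d + 4) * (q * x ^ j)) :=
        Finset.sum_le_sum fun j _ => hterm j
    _ = momentConst d * M * x ^ a * (σ ^ d * ∑ j ∈ Finset.range m, q / (u + q * j) ^ 2 +
          z ^ (d + 4) * ∑ j ∈ Finset.range m, q * x ^ j) := by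
        rw [← Finset.mul_sum, Finset.sum_add_distrib, ← Finset.mul_sum, ← Finset.mul_sum]
    _ ≤ momentConst d * M * Real.exp (-(θ * (q * a))) * (σ ^ d * (2 * σ ^ 2) +
          z ^ (d + 4) * (d * (n : ℝ) ^ 2 / 8)) := by gcongr
    _ = momentConst d * M * Real.exp (-(θ * (q * a))) * (2 * σ ^ (d + 2) +
          d / 8 * z ^ (d + 2)) := by
        have : z ^ (d + 4) * (d * (n : ℝ) ^ 2 / 8) = d / 8 * z ^ (d + 2) := by
          rw [hz, show d + 4 = (d + 2) + 2 by ring, pow_add _ (d + 2)]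
          field_simp
        rw [this]
        ring
    _ ≤ momentConst d * M * Real.exp (-(θ * (q * a))) *
          ((2 + d) * (σ ^ (d + 2) + z ^ (d + 2))) := by
        gcongr
        have e1 : 0 ≤ σ ^ (d + 2) := by positivity
        have e2 : 0 ≤ z ^ (d + 2) := by positivity
        nlinarith
    _ = M * incrementBound d n (q * a) := by
        rw [incrementBound]
        ring

end SecondMoment

/-! ### From the discrete chain back to the process. -/

section Approximation

variable {ι Ω : Type*} [Fintype ι] [DecidableEq ι] [MeasurableSpace Ω] {P : Measure Ω}
  [IsProbabilityMeasure P] {p : Matrix ι ι ℝ} {N : ι → ℝ≥0 → Ω → ℕ} {Y : ℝ≥0 → Ω → ι → ℝ}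

theorem measurable_ringUpdate (p : Matrix ι ι ℝ) (o : Option ι) : Measurable (ringUpdate p o) := by
  cases o with
  | none => exact measurable_id
  | some k =>
    refine measurable_pi_lambda _ fun i => ?_
    by_cases hi : i = k
    · subst hi
      simp only [ringUpdate, siteUpdate, Function.update_self]
      fun_prop
    · simp only [ringUpdate, siteUpdate, Function.update_of_ne hi]
      fun_prop

theorem measurable_ringChain (p : Matrix ι ι ℝ) (J : ℕ → Option ι) (j : ℕ) :
    Measurable fun y => ringChain p J y j := by
  induction j with
  | zero => exact measurable_id
  | succ j ih => exact (measurable_ringUpdate p (J j)).comp ih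

/-- The discretization of the smoothing process on the grid with mesh `ε`. -/
noncomputable def gridChain (p : Matrix ι ι ℝ) (N : ι → ℝ≥0 → Ω → ℕ) (Y : ℝ≥0 → Ω → ι → ℝ)
    (ε : ℝ≥0) (j : ℕ) (ω : Ω) : ι → ℝ :=
  ringChain p (fun i => soleRing (cellIncrement (fun k t => N k t ω) ε i)) (Y 0 ω) j

theorem measurable_gridChain (hS : IsSmoothingProcess p N Y P) (ε : ℝ≥0) (j : ℕ) :
    Measurable (gridChain p N Y ε j) := by
  induction j with
  | zero => exact hS.measurable_init
  | succ j ih =>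
    have h : Measurable fun z : (ι → ℕ) × (ι → ℝ) => ringUpdate p (soleRing z.1) z.2 :=
      measurable_from_prod_countable_right fun x => measurable_ringUpdate p (soleRing x)
    exact h.comp (((measurable_cellIncrement ε j).comp (measurable_clocks hS)).prodMk ih)

theorem ae_clocks_regular (hS : IsSmoothingProcess p N Y P) :
    ∀ᵐ ω ∂P, ∀ k, Monotone (fun t => N k t ω) ∧
      ∀ t, ContinuousWithinAt (fun s => N k s ω) (Set.Ici t) t := by
  rw [ae_all_iff]
  intro k
  filter_upwards [(hS.poisson k).path] with ω hω
  exact hω.2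

theorem ae_eventually_eq_gridChain (hS : IsSmoothingProcess p N Y P) (T : ℝ≥0) (l : ℕ) :
    ∀ᵐ ω ∂P, ∀ᶠ r : ℕ in atTop, ∀ m ≤ l, Y (m * T) ω =
      gridChain p N Y (T / 2 ^ r) (2 ^ r * m) ω := by
  filter_upwards [ae_eventually_atMostOneRing hS T l, hS.path, ae_clocks_regular hS]
    with ω h1 h2 h3
  filter_upwards [h1] with r hr m hm
  have h := h2.eq_ringChain (fun k => (h3 k).1) (fun k => (h3 k).2) (T / 2 ^ r) (2 ^ r * l) hr
    (2 ^ r * m) (Nat.mul_le_mul_left _ hm)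
  rw [gridChain, ← h]
  congr 1
  push_cast
  field_simp

theorem ae_hullLE (hS : IsSmoothingProcess p N Y P) (hp : ∀ i j, 0 ≤ p i j)
    (hp1 : ∀ i, ∑ j, p i j = 1) :
    ∀ᵐ ω ∂P, ∀ s s' : ℝ≥0, s ≤ s' → HullLE (Y s' ω) (Y s ω) := by
  have hl := ae_all_iff.2 fun l => ae_eventually_atMostOneRing hS 1 l
  filter_upwards [hl, hS.path, ae_clocks_regular hS] with ω h1 h2 h3 s s' hs
  obtain ⟨l, hl⟩ := exists_nat_ge s'
  obtain ⟨r, hr⟩ := (h1 l).exists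
  refine h2.hullLE_of_grid (fun k => (h3 k).1) (fun k => (h3 k).2) hp hp1 (1 / 2 ^ r) (2 ^ r * l)
    hr s s' hs (hl.trans (le_of_eq ?_))
  push_cast
  field_simp

/-- Measurability is assumed only at time 0; at later times it comes from the almost sure
approximation by measurable chains. -/
theorem aemeasurable_smoothing (hS : IsSmoothingProcess p N Y P) (T : ℝ≥0) :
    AEMeasurable (Y T) P := by
  refine aemeasurable_of_tendsto_metrizable_ae atTop
    (f := fun r : ℕ => gridChain p N Y (T / 2 ^ r) (2 ^ r * 1))
    (fun r => (measurable_gridChain hS _ _).aemeasurable) ?_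
  filter_upwards [ae_eventually_eq_gridChain hS T 1] with ω hω
  refine tendsto_const_nhds.congr' ?_
  filter_upwards [hω] with r hr
  have h := hr 1 le_rfl
  rwa [Nat.cast_one, one_mul] at h

theorem lintegral_gridChain (hS : IsSmoothingProcess p N Y P) (ε : ℝ≥0) {a b : ℕ} (hab : a ≤ b)
    (H : (ι → ℝ) → (ι → ℝ) → (ι → ℝ) → ℝ) (hH0 : ∀ y z w, 0 ≤ H y z w)
    (hH : Measurable fun x : (ι → ℝ) × (ι → ℝ) × (ι → ℝ) => H x.1 x.2.1 x.2.2) :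
    ∫⁻ ω, ENNReal.ofReal (H (Y 0 ω) (gridChain p N Y ε a ω) (gridChain p N Y ε b ω)) ∂P =
      ∫⁻ ω, ENNReal.ofReal ((chainOp p (ringProb ι ε) ^ a)
        (fun z => (chainOp p (ringProb ι ε) ^ (b - a)) (H (Y 0 ω) z) z) (Y 0 ω)) ∂P := by
  have h := lintegral_soleRing_word hS ε b (fun w y => ENNReal.ofReal
    (H y (ringChain p (extendWord w) y a) (ringChain p (extendWord w) y b))) fun w => by
      have h1 : Measurable fun y => (y, ringChain p (extendWord w) y a,
          ringChain p (extendWord w) y b) :=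
        measurable_id.prodMk ((measurable_ringChain _ _ _).prodMk (measurable_ringChain _ _ _))
      exact (hH.comp h1).ennreal_ofReal
  have hl : ∀ ω, H (Y 0 ω) (gridChain p N Y ε a ω) (gridChain p N Y ε b ω) =
      H (Y 0 ω)
        (ringChain p (extendWord fun j : Fin b =>
          soleRing (cellIncrement (fun k t => N k t ω) ε j)) (Y 0 ω) a)
        (ringChain p (extendWord fun j : Fin b =>
          soleRing (cellIncrement (fun k t => N k t ω) ε j)) (Y 0 ω) b) := by
    intro ω
    rw [ringChain_extendWord p (fun j => soleRing (cellIncrement (fun k t => N k t ω) ε j)) _ hab,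
      ringChain_extendWord p (fun j => soleRing (cellIncrement (fun k t => N k t ω) ε j)) _ le_rfl]
    rfl
  simp only [hl]
  rw [h]
  refine lintegral_congr fun ω => ?_
  have hw : ∀ w : Fin b → Option ι, 0 ≤ ∏ j, ringWeight (ringProb ι ε) (w j) := fun w =>
    Finset.prod_nonneg fun j _ =>
      ringWeight_nonneg (ringProb_nonneg ε) (card_mul_ringProb_le_one ε) _
  simp only [← ENNReal.ofReal_mul (hw _)]
  rw [← ENNReal.ofReal_sum_of_nonneg fun w _ => mul_nonneg (hw w) (hH0 _ _ _),
    sum_word_eq_chainOp_pow_pow p (ringProb ι ε) (H (Y 0 ω)) a b hab]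

/-- Fatou along the dyadic meshes. `H` also sees the initial configuration so that it may carry a
weight depending on it. -/
theorem lintegral_smoothing_le_liminf (hS : IsSmoothingProcess p N Y P) (T : ℝ≥0) {l : ℕ}
    (hl : 1 ≤ l) (H : (ι → ℝ) → (ι → ℝ) → (ι → ℝ) → ℝ) (hH0 : ∀ y z w, 0 ≤ H y z w)
    (hH : Measurable fun x : (ι → ℝ) × (ι → ℝ) × (ι → ℝ) => H x.1 x.2.1 x.2.2) :
    ∫⁻ ω, ENNReal.ofReal (H (Y 0 ω) (Y T ω) (Y (l * T) ω)) ∂P ≤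
      liminf (fun r : ℕ => ∫⁻ ω, ENNReal.ofReal
        ((chainOp p (ringProb ι (T / 2 ^ r)) ^ (2 ^ r))
        (fun z => (chainOp p (ringProb ι (T / 2 ^ r)) ^ (2 ^ r * l - 2 ^ r)) (H (Y 0 ω) z) z)
          (Y 0 ω)) ∂P) atTop := by
  simp only [← lintegral_gridChain hS _ (Nat.le_mul_of_pos_right _ hl) H hH0 hH]
  refine le_trans (le_of_eq ?_) (lintegral_liminf_le fun r => ?_)
  · refine lintegral_congr_ae ?_
    filter_upwards [ae_eventually_eq_gridChain hS T l] with ω hω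
    have h : ∀ᶠ r : ℕ in atTop, ENNReal.ofReal (H (Y 0 ω) (gridChain p N Y (T / 2 ^ r) (2 ^ r) ω)
        (gridChain p N Y (T / 2 ^ r) (2 ^ r * l) ω)) =
        ENNReal.ofReal (H (Y 0 ω) (Y T ω) (Y (l * T) ω)) := by
      filter_upwards [hω] with r hr
      have h1 := hr 1 hl
      rw [Nat.cast_one, one_mul, mul_one] at h1
      rw [h1, hr l le_rfl]
    rw [liminf_congr h, liminf_const]
  · exact (hH.comp (hS.measurable_init.prodMk ((measurable_gridChain hS _ _).prodMk
      (measurable_gridChain hS _ _)))).ennreal_ofReal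

theorem ringProb_pos [Nonempty ι] {ε : ℝ≥0} (hε : 0 < ε) : 0 < ringProb ι ε := by
  have : (0 : ℝ) < ε := by exact_mod_cast hε
  unfold ringProb
  positivity

theorem tendsto_pow_mul_ringProb (T : ℝ≥0) :
    Tendsto (fun r : ℕ => ringProb ι (T / 2 ^ r) * (2 ^ r : ℕ)) atTop (𝓝 T) := by
  have h0 : Tendsto (fun r : ℕ => ((T / 2 ^ r : ℝ≥0) : ℝ)) atTop (𝓝 0) := by
    have h1 := (tendsto_pow_atTop_nhds_zero_of_lt_one (r := (1 / 2 : ℝ))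
      (by norm_num) (by norm_num)).const_mul (T : ℝ)
    rw [mul_zero] at h1
    refine h1.congr fun r => ?_
    push_cast
    rw [one_div, inv_pow, div_eq_mul_inv]
  have h2 : Tendsto (fun r : ℕ => (T : ℝ) *
      Real.exp (-(Fintype.card ι * ((T / 2 ^ r : ℝ≥0) : ℝ)))) atTop (𝓝 T) := by
    have h3 := (Real.continuous_exp.tendsto _).comp ((h0.const_mul (Fintype.card ι : ℝ)).neg)
    have h4 := h3.const_mul (T : ℝ)
    simpa using h4
  refine h2.congr fun r => ?_
  rw [ringProb]
  push_cast
  field_simp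

theorem tendsto_ringProb (T : ℝ≥0) :
    Tendsto (fun r : ℕ => ringProb ι (T / 2 ^ r)) atTop (𝓝 0) := by
  have h1 := (tendsto_pow_mul_ringProb (ι := ι) T).mul
    (tendsto_pow_atTop_nhds_zero_of_lt_one (r := (1 / 2 : ℝ)) (by norm_num) (by norm_num))
  rw [mul_zero] at h1
  refine h1.congr fun r => ?_
  push_cast
  rw [one_div, inv_pow]
  field_simp

end Approximation

/-! ### Bounds for the process, existence of the limit and conclusion. -/

section TorusProcess

variable {d n : ℕ} [NeZero n] {Ω : Type*} [MeasurableSpace Ω] {P : Measure Ω}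
  [IsProbabilityMeasure P] {N : Torus d n → ℝ≥0 → Ω → ℕ} {Y : ℝ≥0 → Ω → Torus d n → ℝ}

theorem sum_torusWalk_left (hd : 1 ≤ d) (hn : 3 ≤ n) (j : Torus d n) :
    ∑ i, torusWalk d n i j = 1 := by
  simp only [torusWalk_symm _ j]
  exact sum_torusWalk hd hn j

theorem three_le_of_large (hd : 1 ≤ d) (hn : 12800 * 5 ^ d * d ≤ n) : 3 ≤ n := by
  have : 1 ≤ 5 ^ d * d := Nat.mul_pos (by positivity) hd
  nlinarith

theorem chainOp_pow_torusAvg_increment_le (hd : 1 ≤ d) (hn : 12800 * 5 ^ d * d ≤ n) {q : ℝ}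
    (hq0 : 0 < q) (hq1 : q ≤ 1 / (7 * (d + 4))) (hcard : Fintype.card (Torus d n) * q ≤ 1)
    (y : Torus d n → ℝ) (c : ℝ) (a m : ℕ) :
    (chainOp (torusWalk d n) q ^ a) (fun z => (chainOp (torusWalk d n) q ^ m)
        (fun w => (torusAvg z - torusAvg w) ^ 2) z) y ≤
      incrementBound d n (q * a) * (torusAvg fun i => |y i - c|) ^ 2 := by
  have hn3 := three_le_of_large hd hn
  have h1 : (fun z => (chainOp (torusWalk d n) q ^ m)
      (fun w => (torusAvg z - torusAvg w) ^ 2) z) = ((((n : ℝ) ^ d)⁻¹) ^ 2) •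
      fun z : Torus d n → ℝ => (chainOp (torusWalk d n) q ^ m)
        (fun w => ((∑ i, w i) - ∑ i, z i) ^ 2) z := by
    funext z
    have h2 : (fun w : Torus d n → ℝ => (torusAvg z - torusAvg w) ^ 2) =
        ((((n : ℝ) ^ d)⁻¹) ^ 2) • fun w => ((∑ i, w i) - ∑ i, z i) ^ 2 := by
      funext w
      simp only [torusAvg, Pi.smul_apply, smul_eq_mul]
      ring
    rw [h2, map_smul]
    rfl
  rw [h1, map_smul, Pi.smul_apply, smul_eq_mul,
    chainOp_pow_increment_sq (sum_torusWalk_left hd hn3)]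
  have h3 := chainOp_pow_increment_le hd hn hq0 hq1 hcard (fun i => y i - c) a m
  simp only [chainOp_pow_dissipation_sub_const (sum_torusWalk hd hn3)] at h3
  calc _ ≤ (((n : ℝ) ^ d)⁻¹) ^ 2 * ((∑ i, |y i - c|) ^ 2 * incrementBound d n (q * a)) :=
        mul_le_mul_of_nonneg_left h3 (sq_nonneg _)
    _ = _ := by
        rw [torusAvg]
        ring

theorem incrementBound_pos (τ : ℝ) : 0 < incrementBound d n τ := by
  have hn0 : (0 : ℝ) < n := Nat.cast_pos.2 (NeZero.pos n)
  have := momentConst_pos d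
  unfold incrementBound
  positivity

theorem continuousAt_incrementBound {τ : ℝ} (hτ : 0 ≤ τ) :
    ContinuousAt (incrementBound d n) τ := by
  have hs : Real.sqrt (1 + τ) ≠ 0 := (Real.sqrt_pos.2 (by linarith)).ne'
  unfold incrementBound
  fun_prop (disch := assumption)

theorem eventually_ringProb_le (T : ℝ≥0) :
    ∀ᶠ r : ℕ in atTop, ringProb (Torus d n) (T / 2 ^ r) ≤ 1 / (7 * ((d : ℝ) + 4)) :=
  (tendsto_ringProb T).eventually_le_const (by positivity)

theorem measurable_torusAvg : Measurable (torusAvg : (Torus d n → ℝ) → ℝ) := by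
  unfold torusAvg
  fun_prop

theorem lintegral_torusAvg_increment_le (hd : 1 ≤ d) (hn : 12800 * 5 ^ d * d ≤ n)
    (hS : IsSmoothingProcess (torusWalk d n) N Y P) {T : ℝ≥0} (hT : 0 < T) {l : ℕ} (hl : 1 ≤ l)
    (c : Ω → ℝ) :
    ∫⁻ ω, ENNReal.ofReal ((torusAvg (Y T ω) - torusAvg (Y (l * T) ω)) ^ 2) ∂P ≤
      ENNReal.ofReal (incrementBound d n T) *
        ∫⁻ ω, ENNReal.ofReal ((torusAvg fun i => |Y 0 ω i - c ω|) ^ 2) ∂P := by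
  set K := ∫⁻ ω, ENNReal.ofReal ((torusAvg fun i => |Y 0 ω i - c ω|) ^ 2) ∂P with hK
  have hmeas : Measurable fun x : (Torus d n → ℝ) × (Torus d n → ℝ) × (Torus d n → ℝ) =>
      (torusAvg x.2.1 - torusAvg x.2.2) ^ 2 :=
    ((measurable_torusAvg.comp measurable_snd.fst).sub
      (measurable_torusAvg.comp measurable_snd.snd)).pow_const 2
  refine (lintegral_smoothing_le_liminf hS T hl
    (fun _ z w => (torusAvg z - torusAvg w) ^ 2) (fun _ _ _ => sq_nonneg _) hmeas).trans ?_
  have hlim : Tendsto (fun r : ℕ => ENNReal.ofReal (incrementBound d n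
      (ringProb (Torus d n) (T / 2 ^ r) * (2 ^ r : ℕ))) * K) atTop
      (𝓝 (ENNReal.ofReal (incrementBound d n T) * K)) := by
    -- `K` may be infinite; the positive limit of the other factor excludes 0 · ∞.
    refine ENNReal.Tendsto.mul_const ?_ (Or.inl ?_)
    · exact ENNReal.tendsto_ofReal
        ((continuousAt_incrementBound T.coe_nonneg).tendsto.comp (tendsto_pow_mul_ringProb T))
    · exact (ENNReal.ofReal_pos.2 (incrementBound_pos _)).ne'
  rw [← hlim.liminf_eq]
  refine liminf_le_liminf ?_
  filter_upwards [eventually_ringProb_le (d := d) (n := n) T] with r hr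
  rw [hK, ← lintegral_const_mul' _ _ ENNReal.ofReal_ne_top]
  refine lintegral_mono fun ω => ?_
  rw [← ENNReal.ofReal_mul (incrementBound_pos _).le]
  exact ENNReal.ofReal_le_ofReal (chainOp_pow_torusAvg_increment_le hd hn
    (ringProb_pos (by positivity)) hr (card_mul_ringProb_le_one _) _ _ _ _)

theorem decay_le_two {u : ℝ} (hu : 0 ≤ u) : decay d n u ≤ 2 := by
  have hn1 : (1 : ℝ) ≤ n := by exact_mod_cast NeZero.pos n
  have h1 : (1 / Real.sqrt (1 + u)) ^ (d + 4) ≤ 1 := by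
    refine pow_le_one₀ (by positivity) ?_
    have : 1 ≤ Real.sqrt (1 + u) := Real.one_le_sqrt.2 (by linarith)
    rw [div_le_one (by linarith)]
    exact this
  have h2 : (1 / (n : ℝ)) ^ (d + 4) ≤ 1 := by
    refine pow_le_one₀ (by positivity) ?_
    rw [div_le_one (by linarith)]
    exact hn1
  rw [decay]
  linarith

theorem measurable_dissipation : Measurable (dissipation (torusWalk d n)) := by
  unfold dissipation
  fun_prop

/-- The initial configuration may have no moments; the weight bounds the integral and, being
positive and constant in time, does not affect almost sure convergence. -/
theorem lintegral_dissipation_le (hd : 1 ≤ d) (hn : 12800 * 5 ^ d * d ≤ n)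
    (hS : IsSmoothingProcess (torusWalk d n) N Y P) {T : ℝ≥0} (hT : 0 < T) :
    ∫⁻ ω, ENNReal.ofReal ((1 + (∑ i, |Y 0 ω i|) ^ 2)⁻¹ *
        dissipation (torusWalk d n) (Y T ω)) ∂P ≤
      ENNReal.ofReal (2 * momentConst d * Real.exp (-(tilt d n * T))) := by
  have hmeas : Measurable fun x : (Torus d n → ℝ) × (Torus d n → ℝ) × (Torus d n → ℝ) =>
      (1 + (∑ i, |x.1 i|) ^ 2)⁻¹ * dissipation (torusWalk d n) x.2.1 := by
    refine Measurable.mul ?_ (measurable_dissipation.comp measurable_snd.fst)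
    fun_prop
  have hweight : ∀ y : Torus d n → ℝ, 0 ≤ (1 + (∑ i, |y i|) ^ 2)⁻¹ := fun y => by positivity
  refine (lintegral_smoothing_le_liminf hS T le_rfl
    (fun y z _ => (1 + (∑ i, |y i|) ^ 2)⁻¹ * dissipation (torusWalk d n) z)
    (fun y z _ => mul_nonneg (hweight y) (dissipation_nonneg _ _)) hmeas).trans ?_
  have hlim : Tendsto (fun r : ℕ => ENNReal.ofReal (2 * momentConst d *
      Real.exp (-(tilt d n * (ringProb (Torus d n) (T / 2 ^ r) * (2 ^ r : ℕ)))))) atTop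
      (𝓝 (ENNReal.ofReal (2 * momentConst d * Real.exp (-(tilt d n * T))))) :=
    ENNReal.tendsto_ofReal (((Real.continuous_exp.tendsto _).comp
      ((tendsto_pow_mul_ringProb T).const_mul _).neg).const_mul _)
  rw [← hlim.liminf_eq]
  refine liminf_le_liminf ?_
  filter_upwards [eventually_ringProb_le (d := d) (n := n) T] with r hr
  have hq0 : 0 < ringProb (Torus d n) (T / 2 ^ r) := ringProb_pos (by positivity)
  set q := ringProb (Torus d n) (T / 2 ^ r) with hq
  refine le_trans (lintegral_mono (g := fun _ => ENNReal.ofReal (2 * momentConst d *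
      Real.exp (-(tilt d n * (q * (2 ^ r : ℕ)))))) fun ω => ENNReal.ofReal_le_ofReal ?_) ?_
  · rw [mul_one, Nat.sub_self]
    have h1 : (fun z => (chainOp (torusWalk d n) q ^ 0) (fun _ => (1 + (∑ i, |Y 0 ω i|) ^ 2)⁻¹ *
        dissipation (torusWalk d n) z) z) =
        (1 + (∑ i, |Y 0 ω i|) ^ 2)⁻¹ • dissipation (torusWalk d n) := by
      funext z
      simp
    rw [h1, map_smul, Pi.smul_apply, smul_eq_mul, inv_mul_le_iff₀ (by positivity)]
    have h2 := chainOp_pow_dissipation_le_decay hd hn hq0 hr (card_mul_ringProb_le_one _)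
      (Y 0 ω) (2 ^ r)
    have hd' : (1 : ℝ) ≤ d := by exact_mod_cast hd
    have hη1 : (1 : ℝ) / (7 * (d + 4)) ≤ 1 / 35 :=
      one_div_le_one_div_of_le (by norm_num) (by linarith)
    obtain ⟨hθ0, hθ4, -⟩ := tilt_bounds (n := n) hd hn
    have hx0 : 0 ≤ 1 - q * tilt d n := by nlinarith
    have h3 : (1 - q * tilt d n) ^ (2 ^ r) ≤ Real.exp (-(tilt d n * (q * (2 ^ r : ℕ)))) := by
      calc _ ≤ Real.exp (-(q * tilt d n)) ^ (2 ^ r) :=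
            pow_le_pow_left₀ hx0 (Real.one_sub_le_exp_neg _) _
        _ = _ := by
            rw [← Real.exp_nat_mul]
            congr 1
            ring
    have h4 : decay d n (q * (2 ^ r : ℕ)) ≤ 2 := decay_le_two (by positivity)
    have hA := momentConst_pos d
    calc _ ≤ _ := h2
      _ ≤ momentConst d * (1 + (∑ i, |Y 0 ω i|) ^ 2) * 2 *
          Real.exp (-(tilt d n * (q * (2 ^ r : ℕ)))) := by
          refine mul_le_mul (mul_le_mul ?_ h4 (decay_nonneg _) (by positivity)) h3
            (pow_nonneg hx0 _) (by positivity)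
          exact mul_le_mul_of_nonneg_left (by linarith) hA.le
      _ = _ := by ring
  · rw [lintegral_const, measure_univ, mul_one]

theorem ae_tendsto_dissipation (hd : 1 ≤ d) (hn : 12800 * 5 ^ d * d ≤ n)
    (hS : IsSmoothingProcess (torusWalk d n) N Y P) :
    ∀ᵐ ω ∂P, Tendsto (fun m : ℕ => dissipation (torusWalk d n) (Y ((m + 1 : ℕ) : ℝ≥0) ω)) atTop
      (𝓝 0) := by
  obtain ⟨hθ0, -, -⟩ := tilt_bounds (n := n) hd hn
  set g : ℕ → Ω → ℝ≥0∞ := fun m ω => ENNReal.ofReal ((1 + (∑ i, |Y 0 ω i|) ^ 2)⁻¹ *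
    dissipation (torusWalk d n) (Y ((m + 1 : ℕ) : ℝ≥0) ω)) with hg
  have hgm : ∀ m, AEMeasurable (g m) P := by
    intro m
    refine AEMeasurable.ennreal_ofReal (AEMeasurable.mul ?_
      (measurable_dissipation.comp_aemeasurable (aemeasurable_smoothing hS _)))
    have h : Measurable fun y : Torus d n → ℝ => (1 + (∑ i, |y i|) ^ 2)⁻¹ := by fun_prop
    exact (h.comp hS.measurable_init).aemeasurable
  have hsum : ∫⁻ ω, ∑' m, g m ω ∂P ≠ ∞ := by
    rw [lintegral_tsum hgm]
    refine ne_top_of_le_ne_top ?_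
      (ENNReal.tsum_le_tsum fun m => lintegral_dissipation_le hd hn hS (by positivity))
    have hs : Summable fun m : ℕ => 2 * momentConst d *
        Real.exp (-(tilt d n * (((m + 1 : ℕ) : ℝ≥0) : ℝ))) := by
      refine Summable.mul_left _ ?_
      have h1 : Summable fun m : ℕ => Real.exp (-(tilt d n)) ^ m :=
        summable_geometric_of_lt_one (Real.exp_nonneg _) (Real.exp_lt_one_iff.2 (by linarith))
      refine (h1.mul_left (Real.exp (-(tilt d n)))).congr fun m => ?_
      rw [← Real.exp_nat_mul, ← Real.exp_add]
      congr 1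
      push_cast
      ring
    exact hs.tsum_ofReal_ne_top
  filter_upwards [ae_lt_top' (AEMeasurable.tsum hgm) hsum] with ω hω
  have h1 := ENNReal.tendsto_atTop_zero_of_tsum_ne_top hω.ne
  have h2 := (ENNReal.tendsto_toReal ENNReal.zero_ne_top).comp h1
  have h3 := h2.const_mul (1 + (∑ i, |Y 0 ω i|) ^ 2)
  rw [ENNReal.toReal_zero, mul_zero] at h3
  refine h3.congr fun m => ?_
  have hpos : 0 < 1 + (∑ i, |Y 0 ω i|) ^ 2 := by positivity
  simp only [hg, Function.comp_apply]
  rw [ENNReal.toReal_ofReal (mul_nonneg (by positivity) (dissipation_nonneg _ _)),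
    mul_inv_cancel_left₀ hpos.ne']

/-- A Poincaré inequality: centring kills the zero mode, and λ_k is at least the gap on the others.
-/
theorem sq_sub_torusAvg_le (hd : 1 ≤ d) (hn : 3 ≤ n) (y : Torus d n → ℝ) (i : Torus d n) :
    (cycleGap n / d) ^ 2 * (y i - torusAvg y) ^ 2 ≤ dissipation (torusWalk d n) y := by
  have hD : (0 : ℝ) < (n : ℝ) ^ d := pow_pos (Nat.cast_pos.2 (NeZero.pos n)) d
  have hγ0 : 0 ≤ cycleGap n / d := by
    have h1 := le_cycleGap (n := n) (by omega)
    have h2 : 0 ≤ 8 / (n : ℝ) ^ 2 := by positivity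
    exact div_nonneg (h2.trans h1) (Nat.cast_nonneg d)
  -- The power 0 leaves the plain invariance of the dissipation under a shift.
  have h1 := chainOp_pow_dissipation_sub_const (sum_torusWalk hd hn) 0 (torusAvg y) 0 y
  simp only [pow_zero, Module.End.one_apply] at h1
  rw [← h1, dissipation_eq_sum hd hn]
  set z : Torus d n → ℝ := fun i => y i - torusAvg y with hz
  have h0 : torusFourier z 0 = 0 := by
    have h2 : ∑ i, z i = 0 := by
      simp only [hz, Finset.sum_sub_distrib, Finset.sum_const, Finset.card_univ, card_torus,
        nsmul_eq_mul, torusAvg, Nat.cast_pow]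
      rw [mul_inv_cancel_left₀ hD.ne', sub_self]
    have h3 : torusFourier z 0 = ((∑ i, z i : ℝ) : ℂ) := by
      simp [torusFourier, torusChar]
    rw [h3, h2, Complex.ofReal_zero]
  have h4 : ∀ k : Torus d n, (cycleGap n / d) ^ 2 * Complex.normSq (torusFourier z k) ≤
      torusEigen k ^ 2 * Complex.normSq (torusFourier z k) := by
    intro k
    by_cases hk : k = 0
    · subst hk
      simp [h0]
    · refine mul_le_mul_of_nonneg_right ?_ (Complex.normSq_nonneg _)
      exact pow_le_pow_left₀ hγ0 (gap_le_torusEigen hd hk) 2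
  have h5 : (y i - torusAvg y) ^ 2 ≤ ∑ i, z i ^ 2 :=
    Finset.single_le_sum (f := fun i => z i ^ 2) (fun i _ => sq_nonneg _) (Finset.mem_univ i)
  have h6 := Finset.sum_le_sum fun k (_ : k ∈ Finset.univ) => h4 k
  rw [← Finset.mul_sum, sum_normSq_torusFourier] at h6
  rw [le_inv_mul_iff₀ hD]
  refine le_trans ?_ h6
  calc (n : ℝ) ^ d * ((cycleGap n / d) ^ 2 * (y i - torusAvg y) ^ 2)
      ≤ (n : ℝ) ^ d * ((cycleGap n / d) ^ 2 * ∑ i, z i ^ 2) := by gcongr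
    _ = _ := by ring

theorem torusAvg_mem_Icc {y : Torus d n → ℝ} {a b : ℝ} (h : ∀ i, y i ∈ Set.Icc a b) :
    torusAvg y ∈ Set.Icc a b := by
  have hD : (0 : ℝ) < (n : ℝ) ^ d := pow_pos (Nat.cast_pos.2 (NeZero.pos n)) d
  have hc : ∀ c : ℝ, ∑ _i : Torus d n, c = (n : ℝ) ^ d * c := fun c => by
    rw [Finset.sum_const, Finset.card_univ, card_torus, nsmul_eq_mul, Nat.cast_pow]
  constructor
  · rw [torusAvg, le_inv_mul_iff₀ hD, ← hc]
    exact Finset.sum_le_sum fun i _ => (h i).1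
  · rw [torusAvg, inv_mul_le_iff₀ hD, ← hc]
    exact Finset.sum_le_sum fun i _ => (h i).2

/-- At some integer time all values lie within ε/2 of their average; every later configuration, and
so its average, stays in that interval. -/
theorem ae_tendsto_torusAvg (hd : 1 ≤ d) (hn : 12800 * 5 ^ d * d ≤ n)
    (hS : IsSmoothingProcess (torusWalk d n) N Y P) :
    ∀ᵐ ω ∂P, Tendsto (fun t => torusAvg (Y t ω)) atTop
      (𝓝 (torusAvgLimit fun t => Y t ω)) := by
  have hn3 := three_le_of_large hd hn
  filter_upwards [ae_tendsto_dissipation hd hn hS,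
    ae_hullLE hS torusWalk_nonneg (sum_torusWalk hd hn3)] with ω h1 h2
  refine tendsto_nhds_limUnder (cauchySeq_tendsto_of_complete (Metric.cauchySeq_iff'.2 ?_))
  intro ε hε
  have hγ : 0 < cycleGap n / d := by
    have h3 := le_cycleGap (n := n) (by omega)
    have hn0 : (0 : ℝ) < n := Nat.cast_pos.2 (NeZero.pos n)
    have h4 : 0 < 8 / (n : ℝ) ^ 2 := by positivity
    have : 0 < cycleGap n := h4.trans_le h3
    positivity
  set γ := cycleGap n / d with hγdef
  obtain ⟨m, hm⟩ := (h1.eventually_lt_const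
    (show 0 < (γ * (ε / 2)) ^ 2 by positivity)).exists
  refine ⟨((m + 1 : ℕ) : ℝ≥0), fun t ht => ?_⟩
  set y := Y ((m + 1 : ℕ) : ℝ≥0) ω with hy
  have hI : ∀ i, y i ∈ Set.Icc (torusAvg y - ε / 2) (torusAvg y + ε / 2) := by
    intro i
    have h3 := (sq_sub_torusAvg_le hd hn3 y i).trans hm.le
    rw [mul_pow] at h3
    have h4 := le_of_mul_le_mul_left h3 (by positivity)
    have h5 := abs_le_of_sq_le_sq' h4 (by positivity)
    constructor <;> linarith [h5.1, h5.2]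
  have h6 := torusAvg_mem_Icc (h2 _ t ht _ _ hI)
  rw [Real.dist_eq, abs_lt]
  constructor <;> linarith [h6.1, h6.2]

/-- Fatou again, along the multiples (l + 1)T, which are grid points of every mesh T/2^r. -/
theorem lintegral_torusAvg_sub_limit_le (hd : 1 ≤ d) (hn : 12800 * 5 ^ d * d ≤ n)
    (hS : IsSmoothingProcess (torusWalk d n) N Y P) {T : ℝ≥0} (hT : 0 < T) (c : Ω → ℝ) :
    ∫⁻ ω, ENNReal.ofReal ((torusAvg (Y T ω) - torusAvgLimit fun s => Y s ω) ^ 2) ∂P ≤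
      ENNReal.ofReal (incrementBound d n T) *
        ∫⁻ ω, ENNReal.ofReal ((torusAvg fun i => |Y 0 ω i - c ω|) ^ 2) ∂P := by
  set g : ℕ → Ω → ℝ≥0∞ := fun l ω =>
    ENNReal.ofReal ((torusAvg (Y T ω) - torusAvg (Y ((l + 1 : ℕ) * T) ω)) ^ 2) with hg
  have hgm : ∀ l, AEMeasurable (g l) P := fun l =>
    (((measurable_torusAvg.comp_aemeasurable (aemeasurable_smoothing hS _)).sub
      (measurable_torusAvg.comp_aemeasurable (aemeasurable_smoothing hS _))).pow_const
      2).ennreal_ofReal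
  have htime : Tendsto (fun l : ℕ => ((l + 1 : ℕ) : ℝ≥0) * T) atTop atTop :=
    (tendsto_natCast_atTop_atTop.comp (tendsto_add_atTop_nat 1)).atTop_mul_const hT
  calc _ = ∫⁻ ω, liminf (fun l => g l ω) atTop ∂P := by
        refine lintegral_congr_ae ?_
        filter_upwards [ae_tendsto_torusAvg hd hn hS] with ω hω
        exact (ENNReal.tendsto_ofReal
          ((tendsto_const_nhds.sub (hω.comp htime)).pow 2)).liminf_eq.symm
    _ ≤ liminf (fun l => ∫⁻ ω, g l ω ∂P) atTop := lintegral_liminf_le' hgm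
    _ ≤ liminf (fun _ : ℕ => ENNReal.ofReal (incrementBound d n T) *
        ∫⁻ ω, ENNReal.ofReal ((torusAvg fun i => |Y 0 ω i - c ω|) ^ 2) ∂P) atTop :=
        liminf_le_liminf (Eventually.of_forall fun l =>
          lintegral_torusAvg_increment_le hd hn hS hT (by omega) c)
    _ = _ := liminf_const _

theorem incrementBound_le {t : ℝ} (ht : 0 < t) :
    incrementBound d n t ≤ 2 * momentConst d * (2 + d) /
        min (t ^ ((d : ℝ) / 2 + 1)) ((n : ℝ) ^ (d + 2)) *
      Real.exp (-(2 * cycleGap n / d - gapLoss d / (n : ℝ) ^ (d + 4)) * t) := by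
  have hn0 : (0 : ℝ) < n := Nat.cast_pos.2 (NeZero.pos n)
  have hA := momentConst_pos d
  have hroot : t ^ ((d : ℝ) / 2 + 1) = Real.sqrt t ^ (d + 2) := by
    rw [Real.sqrt_eq_rpow, ← Real.rpow_natCast, ← Real.rpow_mul ht.le]
    congr 1
    push_cast
    ring
  have hst : 0 < Real.sqrt t := Real.sqrt_pos.2 ht
  set μ := min (t ^ ((d : ℝ) / 2 + 1)) ((n : ℝ) ^ (d + 2)) with hμ
  have hμ0 : 0 < μ := lt_min (by rw [hroot]; positivity) (by positivity)
  have h1 : (1 / Real.sqrt (1 + t)) ^ (d + 2) ≤ 1 / μ := by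
    rw [div_pow, one_pow]
    refine one_div_le_one_div_of_le hμ0 ((min_le_left _ _).trans ?_)
    rw [hroot]
    exact pow_le_pow_left₀ hst.le (Real.sqrt_le_sqrt (by linarith)) _
  have h2 : (1 / (n : ℝ)) ^ (d + 2) ≤ 1 / μ := by
    rw [div_pow, one_pow]
    exact one_div_le_one_div_of_le hμ0 (min_le_right _ _)
  have h3 : -(tilt d n * t) = -(2 * cycleGap n / d - gapLoss d / (n : ℝ) ^ (d + 4)) * t := by
    rw [tilt, mul_div_assoc]
    ring
  rw [incrementBound, h3]
  refine mul_le_mul_of_nonneg_right ?_ (Real.exp_nonneg _)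
  calc _ ≤ momentConst d * (2 + d) * (1 / μ + 1 / μ) := by gcongr
    _ = _ := by ring

end TorusProcess

theorem theorem2p5 (d : ℕ) (hd : 1 ≤ d) :
    ∃ α₂ > (0 : ℝ), ∃ α₃ > (0 : ℝ), ∃ n₀ ≥ (3 : ℕ), ∃ t₀ > (0 : ℝ),
      ∀ (n : ℕ) [NeZero n], n₀ ≤ n → Odd n →
      ∀ (Ω : Type*) [MeasurableSpace Ω] (P : Measure Ω) [IsProbabilityMeasure P]
        (N : Torus d n → ℝ≥0 → Ω → ℕ) (Y : ℝ≥0 → Ω → Torus d n → ℝ) (ystar : Ω → ℝ),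
        IsSmoothingProcess (torusWalk d n) N Y P →
        (∀ ω, IsMedian (Y 0 ω) (ystar ω)) →
        (∀ᵐ ω ∂P, Tendsto (fun t => torusAvg (Y t ω)) atTop
          (𝓝 (torusAvgLimit fun t => Y t ω))) ∧
        ∀ t : ℝ≥0, t₀ ≤ (t : ℝ) →
          ∫⁻ ω, ENNReal.ofReal ((torusAvg (Y t ω) - torusAvgLimit fun s => Y s ω) ^ 2) ∂P ≤
            ENNReal.ofReal
                (α₂ / min ((t : ℝ) ^ ((d : ℝ) / 2 + 1)) ((n : ℝ) ^ (d + 2))) *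
              (∫⁻ ω, ENNReal.ofReal ((torusAvg fun i => |Y 0 ω i - ystar ω|) ^ 2) ∂P) *
              ENNReal.ofReal
                (Real.exp (-(2 * cycleGap n / d - α₃ / (n : ℝ) ^ (d + 4)) * t)) := by
  -- The 2 arises because both terms of `incrementBound` are at most the reciprocal of the minimum;
  -- t₀ = 1 is arbitrary, as only t > 0 matters.
  refine ⟨2 * momentConst d * (2 + d), ?_, gapLoss d, ?_, 12800 * 5 ^ d * d, ?_, 1, one_pos, ?_⟩
  · have := momentConst_pos d
    positivity
  · unfold gapLoss
    positivity
  · have : 1 ≤ 5 ^ d * d := Nat.mul_pos (by positivity) hd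
    nlinarith
  · intro n _ hn _ Ω _ P _ N Y ystar hS _
    refine ⟨ae_tendsto_torusAvg hd hn hS, fun t ht => ?_⟩
    have ht0 : 0 < (t : ℝ) := by linarith
    refine (lintegral_torusAvg_sub_limit_le hd hn hS (by exact_mod_cast ht0) ystar).trans ?_
    rw [mul_right_comm, ← ENNReal.ofReal_mul]
    · gcongr
      exact incrementBound_le ht0
    · have hn0 : (0 : ℝ) < n := Nat.cast_pos.2 (NeZero.pos n)
      have := momentConst_pos d
      positivity
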